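/- All graphs are finite, simple, undirected, and have at least one vertex; graphs are considered up to isomorphism. For non-adjacent distinct vertices $a,b$ of a graph $G$, an $a,b$-separator is a set $S\subseteq V(G)\setminus\{a,b\}$ such that $a$ and $b$ lie in different connected components of $G-S$; it is a minimal $a,b$-separator if no proper subset of it is an $a,b$-separator. A minimal separator of $G$ is a minimal $a,b$-separator for some pair of non-adjacent distinct vertices $a,b$, and $s(G)$ denotes the number of minimal separators of $G$. A class $\mathcal{G}$ of graphs is tame if there is a real polynomial $p$ such that $s(G)\le p(|V(G)|)$ for all $G\in\mathcal{G}$. For a family $\mathcal{F}$ of graphs, a graph is $\mathcal{F}$-free if no induced subgraph of it is isomorphic to a member of $\mathcal{F}$; we write $\mathcal{F}'\trianglelefteq\mathcal{F}$ if every $\mathcal{F}'$-free graph is $\mathcal{F}$-free. Here $kP_1$ is the graph with $k$ vertices and no edges, $K_n$ and $C_n$ are the complete graph and the cycle on $n$ vertices, the claw is $K_{1,3}$, and the diamond is $K_4$ minus an edge. Theorem. Let $\mathcal{F}$ be a family of graphs, each with at most four vertices, such that $\mathcal{F}\neq\{4P_1,C_4\}$ and $\mathcal{F}\neq\{4P_1,C_4,\text{claw}\}$.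 Then the class of $\mathcal{F}$-free graphs is not tame if and only if $\mathcal{F}'\trianglelefteq\mathcal{F}$ for at least one of the following families $\mathcal{F}'$: (i) $\mathcal{F}'=\{3P_1,\text{diamond}\}$; (ii) $\mathcal{F}'=\{\text{claw},K_4,C_4,\text{diamond}\}$; (iii) $\mathcal{F}'=\{K_3,C_4\}$. -/

import Mathlib

/-- A graph: finite, simple, undirected, with at least one vertex. -/
structure FinGraph where
  V : Type
  [finite : Finite V]
  [nonempty : Nonempty V]
  graph : SimpleGraph V

attribute [instance] FinGraph.finite FinGraph.nonempty

namespace FinGraph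

/-- Two graphs are isomorphic. -/
def Iso (G H : FinGraph) : Prop := Nonempty (G.graph ≃g H.graph)

/-- The order `|V(G)|` of a graph. -/
noncomputable def order (G : FinGraph) : ℕ := Nat.card G.V

/-- `S` is an `a,b`-separator of `G`: it avoids `a` and `b`, which lie in different
connected components of `G - S`. -/
def IsSeparator {V : Type} (G : SimpleGraph V) (a b : V) (S : Set V) : Prop :=
  ∃ (ha : a ∈ Sᶜ) (hb : b ∈ Sᶜ),
    (G.induce Sᶜ).connectedComponentMk ⟨a, ha⟩ ≠ (G.induce Sᶜ).connectedComponentMk ⟨b, hb⟩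

/-- `S` is a minimal `a,b`-separator: no proper subset of it is an `a,b`-separator. -/
def IsMinSeparatorOf {V : Type} (G : SimpleGraph V) (a b : V) (S : Set V) : Prop :=
  IsSeparator G a b S ∧ ∀ T : Set V, T ⊂ S → ¬ IsSeparator G a b T

/-- The set of all minimal separators of `G`, that is, of all minimal `a,b`-separators, where
`a` and `b` range over the pairs of distinct non-adjacent vertices. -/
def minSeparators (G : FinGraph) : Set (Set G.V) :=
  {S | ∃ a b : G.V, a ≠ b ∧ ¬ G.graph.Adj a b ∧ IsMinSeparatorOf G.graph a b S}

/-- The number `s(G)` of minimal separators of `G`. -/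
noncomputable def numMinSeparators (G : FinGraph) : ℕ := G.minSeparators.ncard

/-- A class of graphs is tame if the number of minimal separators of its members is bounded by
a real polynomial in the number of vertices. -/
def Tame (C : Set FinGraph) : Prop :=
  ∃ p : Polynomial ℝ, ∀ G ∈ C, (G.numMinSeparators : ℝ) ≤ p.eval (G.order : ℝ)

/-- The class of `F`-free graphs: no induced subgraph is isomorphic to a member of `F`. -/
def freeClass (F : Set FinGraph) : Set FinGraph :=
  {G | ∀ H ∈ F, ¬ H.graph.IsIndContained G.graph}

/-- The relation `F ⊴ F'` between families of graphs: every `F`-free graph is `F'`-free. -/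
def FamilyLE (F F' : Set FinGraph) : Prop := freeClass F ⊆ freeClass F'

/-- Equality of families of graphs, where isomorphic graphs are identified. -/
def FamilyEq (F F' : Set FinGraph) : Prop :=
  (∀ H ∈ F, ∃ H' ∈ F', Iso H H') ∧ (∀ H' ∈ F', ∃ H ∈ F, Iso H H')

/-- Three isolated vertices. -/
def threeP1 : FinGraph := ⟨Fin 3, ⊥⟩

/-- Four isolated vertices. -/
def fourP1 : FinGraph := ⟨Fin 4, ⊥⟩

/-- The complete graph on three vertices. -/
def K3 : FinGraph := ⟨Fin 3, ⊤⟩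

/-- The complete graph on four vertices. -/
def K4 : FinGraph := ⟨Fin 4, ⊤⟩

/-- The cycle on four vertices. -/
def C4 : FinGraph := ⟨Fin 4, SimpleGraph.cycleGraph 4⟩

/-- The claw: the complete bipartite graph with parts of sizes one and three. -/
def claw : FinGraph := ⟨Fin 1 ⊕ Fin 3, completeBipartiteGraph (Fin 1) (Fin 3)⟩

/-- The diamond: the complete graph on four vertices minus one edge. -/
def diamond : FinGraph := ⟨Fin 4, (⊤ : SimpleGraph (Fin 4)).deleteEdges {s(0, 1)}⟩

end FinGraph

/-! A minimal separator `S` comes with two full components: components `A`, `B` of `G - S` such that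
every vertex of `S` has a neighbour in both (`exists_fullPair`). If some `T ⊆ A` with at most `K`
vertices dominates `S`, then for `b ∈ B` the component of `b` in `G - N(T)` is exactly `B`, and `S =
N(B)`. The pair `(T, b)` therefore determines `S`, which leaves only polynomially many separators
(`tame_of_dom`). So tameness follows once `S` is always dominated by boundedly many vertices of one
side; this is shown for each combination in `TameExclusion`.

The relation `F' ⊴ F` fails exactly when `F` has an `F'`-free member. If (i), (ii), (iii) all fail,
`F` contains three such witnesses. Having at most four vertices, each of them excludes from the
`F`-free graphs one of a short list of four-vertex graphs. Every combination of the three exclusions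
falls under `TameExclusion`, unless the only graphs excluded are `4P₁`, `C₄` and possibly the claw;
then the hypotheses on `F` supply one more member, which settles the case (`tame_freeClass`).

Conversely, tameness passes to subclasses, so it suffices that the three classes in (i)-(iii) are
not tame. Each contains ladders: two copies of a graph joined by rungs. Removing one end of every
rung, chosen independently, gives exponentially many minimal separators
(`two_pow_le_numMinSeparators`). -/

namespace FinGraph

open Relation

/-! ### Full components of minimal separators, and counting by dominating sets -/

section Components

variable {V : Type} {G : SimpleGraph V} {A B S : Set V}

/-- A step along an edge of `G` to a vertex outside `Z`. -/
def Step (G : SimpleGraph V) (Z : Set V) (x y : V) : Prop := G.Adj x y ∧ y ∉ Z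

/-- The vertices that can be reached from `b` in `G - Z`. -/
def comp (G : SimpleGraph V) (Z : Set V) (b : V) : Set V := {v | ReflTransGen (Step G Z) b v}

/-- The vertices outside `A` with a neighbour in `A`. -/
def nbhd (G : SimpleGraph V) (A : Set V) : Set V := {v | v ∉ A ∧ ∃ a ∈ A, G.Adj a v}

theorem reachable_induce_iff {a b : V} (ha : a ∈ Sᶜ) (hb : b ∈ Sᶜ) :
    (G.induce Sᶜ).Reachable ⟨a, ha⟩ ⟨b, hb⟩ ↔ b ∈ comp G S a := by
  constructor
  · rintro ⟨w⟩
    have key : ∀ (x y : (Sᶜ : Set V)), (G.induce Sᶜ).Walk x y → y.1 ∈ comp G S x.1 := by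
      intro x y w
      induction w with
      | nil => exact ReflTransGen.refl
      | @cons u v w h p ih => exact ReflTransGen.head ⟨h, v.2⟩ ih
    exact key _ _ w
  · intro h
    have key : ∀ v, ReflTransGen (Step G S) a v →
        ∃ hv : v ∈ Sᶜ, (G.induce Sᶜ).Reachable ⟨a, ha⟩ ⟨v, hv⟩ := by
      intro v hv
      induction hv with
      | refl => exact ⟨ha, SimpleGraph.Reachable.refl _⟩
      | @tail x y _ hxy ih =>
        obtain ⟨hx, hr⟩ := ih
        exact ⟨hxy.2, hr.trans (SimpleGraph.Adj.reachable
          (show (G.induce Sᶜ).Adj ⟨x, hx⟩ ⟨y, hxy.2⟩ from hxy.1))⟩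
    exact (key b h).2

theorem isSeparator_iff {a b : V} :
    IsSeparator G a b S ↔ a ∉ S ∧ b ∉ S ∧ b ∉ comp G S a := by
  constructor
  · rintro ⟨ha, hb, h⟩
    refine ⟨ha, hb, fun hc => h ?_⟩
    exact SimpleGraph.ConnectedComponent.sound ((reachable_induce_iff ha hb).2 hc)
  · rintro ⟨ha, hb, h⟩
    exact ⟨ha, hb, fun hc => h ((reachable_induce_iff ha hb).1
      (SimpleGraph.ConnectedComponent.exact hc))⟩

/-- `A` and `B` are the vertex sets of two components of `G - S` such that each vertex of `S` has
a neighbour in both. -/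
structure FullPair (G : SimpleGraph V) (A B S : Set V) : Prop where
  nonempty_left : A.Nonempty
  nonempty_right : B.Nonempty
  conn_left : ∀ a ∈ A, ∀ a' ∈ A, a' ∈ comp G Aᶜ a
  conn_right : ∀ b ∈ B, ∀ b' ∈ B, b' ∈ comp G Bᶜ b
  disj : ∀ v ∈ A, v ∉ B
  disj_left : ∀ v ∈ A, v ∉ S
  disj_right : ∀ v ∈ B, v ∉ S
  nbr_left : ∀ a ∈ A, ∀ v, G.Adj a v → v ∈ A ∨ v ∈ S
  nbr_right : ∀ b ∈ B, ∀ v, G.Adj b v → v ∈ B ∨ v ∈ S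
  full_left : ∀ s ∈ S, ∃ a ∈ A, G.Adj s a
  full_right : ∀ s ∈ S, ∃ b ∈ B, G.Adj s b

theorem FullPair.symm (h : FullPair G A B S) : FullPair G B A S where
  nonempty_left := h.nonempty_right
  nonempty_right := h.nonempty_left
  conn_left := h.conn_right
  conn_right := h.conn_left
  disj v hB hA := h.disj v hA hB
  disj_left := h.disj_right
  disj_right := h.disj_left
  nbr_left := h.nbr_right
  nbr_right := h.nbr_left
  full_left := h.full_right
  full_right := h.full_left

theorem FullPair.not_adj (h : FullPair G A B S) {a b : V} (ha : a ∈ A) (hb : b ∈ B) :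
    ¬ G.Adj a b := fun hab => by
  rcases h.nbr_left a ha b hab with h' | h'
  · exact h.disj b h' hb
  · exact h.disj_right b hb h'

theorem FullPair.ne (h : FullPair G A B S) {a b : V} (ha : a ∈ A) (hb : b ∈ B) : a ≠ b := by
  rintro rfl; exact h.disj a ha hb

theorem FullPair.ne_sep (h : FullPair G A B S) {a s : V} (ha : a ∈ A) (hs : s ∈ S) : a ≠ s := by
  rintro rfl; exact h.disj_left a ha hs

theorem comp_subset {Z P : Set V} {b : V} (hb : b ∈ P)
    (hP : ∀ x ∈ P, ∀ y, G.Adj x y → y ∉ Z → y ∈ P) : comp G Z b ⊆ P := by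
  intro v hv
  induction hv with
  | refl => exact hb
  | @tail x y _ hxy ih => exact hP x ih y hxy.1 hxy.2

/-- A `Step` tests only its end, so `comp G Z a` contains `a` even when `a ∈ Z`; hence symmetry
needs `a ∉ Z`. -/
theorem comp_symm {Z : Set V} {a b : V} (ha : a ∉ Z) (h : b ∈ comp G Z a) :
    a ∈ comp G Z b := by
  have key : b ∉ Z ∧ a ∈ comp G Z b := by
    induction h with
    | refl => exact ⟨ha, ReflTransGen.refl⟩
    | @tail x y _ hxy ih => exact ⟨hxy.2, ReflTransGen.head ⟨hxy.1.symm, ih.1⟩ ih.2⟩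
  exact key.2

theorem comp_trans {Z : Set V} {a b c : V} (h : b ∈ comp G Z a) (h' : c ∈ comp G Z b) :
    c ∈ comp G Z a := ReflTransGen.trans h h'

theorem comp_notMem {Z : Set V} {a b : V} (ha : a ∉ Z) (h : b ∈ comp G Z a) : b ∉ Z :=
  comp_subset (P := Zᶜ) ha (fun _ _ _ _ h => h) h

theorem conn_comp {Z : Set V} {a : V} :
    ∀ x ∈ comp G Z a, ∀ y ∈ comp G Z a, y ∈ comp G (comp G Z a)ᶜ x := by
  have key : ∀ x ∈ comp G Z a, x ∈ comp G (comp G Z a)ᶜ a := by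
    intro x hx
    have : x ∈ comp G Z a ∧ x ∈ comp G (comp G Z a)ᶜ a := by
      induction hx with
      | refl => exact ⟨ReflTransGen.refl, ReflTransGen.refl⟩
      | @tail u v huv hstep ih =>
        have hv : v ∈ comp G Z a := ReflTransGen.tail huv hstep
        exact ⟨hv, ReflTransGen.tail ih.2 ⟨hstep.1, fun h => h hv⟩⟩
    exact this.2
  intro x hx y hy
  exact comp_trans (comp_symm (fun h => h ReflTransGen.refl) (key x hx)) (key y hy)

theorem comp_mono {Z Z' : Set V} {b : V}
    (h : ∀ x y, G.Adj x y → y ∉ Z → y ∉ Z') : comp G Z b ⊆ comp G Z' b := by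
  intro v hv
  induction hv with
  | refl => exact ReflTransGen.refl
  | @tail x y _ hxy ih => exact ReflTransGen.tail ih ⟨hxy.1, h x y hxy.1 hxy.2⟩

/-- By minimality, putting `s ∈ S` back reconnects `a` and `b`. If `s` had no neighbour in one of
the two components, that component would stay closed after `s` is put back. -/
theorem exists_fullPair {a b : V} (h : IsMinSeparatorOf G a b S) :
    FullPair G (comp G S a) (comp G S b) S := by
  obtain ⟨hsep, hmin⟩ := h
  obtain ⟨ha, hb, hab⟩ := isSeparator_iff.1 hsep
  have hdisj : ∀ v ∈ comp G S a, v ∉ comp G S b := fun v hva hvb =>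
    hab (comp_trans hva (comp_symm hb hvb))
  have hnbr : ∀ {c : V}, ∀ x ∈ comp G S c, ∀ v, G.Adj x v → v ∈ comp G S c ∨ v ∈ S := by
    intro c x hx v hxv
    by_cases hv : v ∈ S
    · exact Or.inr hv
    · exact Or.inl (ReflTransGen.tail hx ⟨hxv, hv⟩)
  have hfull : ∀ s ∈ S, b ∈ comp G (S \ {s}) a := by
    intro s hs
    by_contra hcon
    exact hmin (S \ {s}) ⟨Set.sdiff_subset, fun h => (h hs).2 rfl⟩
      (isSeparator_iff.2 ⟨fun h => ha h.1, fun h => hb h.1, hcon⟩)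
  have hex : ∀ {c d : V} (s : V), d ∈ comp G (S \ {s}) c → d ∉ comp G S c →
      ∃ x ∈ comp G S c, G.Adj s x := by
    intro c d s hd hcd
    by_contra! hno
    refine hcd (comp_subset (P := comp G S c) ReflTransGen.refl ?_ hd)
    intro x hx y hxy hy
    have hys : y ≠ s := by rintro rfl; exact hno x hx hxy.symm
    exact ReflTransGen.tail hx ⟨hxy, fun hyS => hy ⟨hyS, hys⟩⟩
  exact
    { nonempty_left := ⟨a, ReflTransGen.refl⟩
      nonempty_right := ⟨b, ReflTransGen.refl⟩
      conn_left := conn_comp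
      conn_right := conn_comp
      disj := hdisj
      disj_left := fun v hv => comp_notMem ha hv
      disj_right := fun v hv => comp_notMem hb hv
      nbr_left := hnbr
      nbr_right := hnbr
      full_left := fun s hs => hex s (hfull s hs) hab
      full_right := fun s hs => hex s (comp_symm (fun h => ha h.1) (hfull s hs))
        (fun h => hab (comp_symm hb h)) }

theorem FullPair.isMinSeparatorOf (h : FullPair G A B S) {a b : V} (ha : a ∈ A) (hb : b ∈ B) :
    IsMinSeparatorOf G a b S := by
  refine ⟨isSeparator_iff.2 ⟨h.disj_left a ha, h.disj_right b hb, fun hc => ?_⟩, ?_⟩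
  · refine h.disj b (comp_subset (P := A) ha (fun x hx y hxy hy => ?_) hc) hb
    exact (h.nbr_left x hx y hxy).resolve_right hy
  · intro T hT hsep
    obtain ⟨-, -, hc⟩ := isSeparator_iff.1 hsep
    obtain ⟨s, hsS, hsT⟩ := Set.exists_of_ssubset hT
    obtain ⟨x, hx, hsx⟩ := h.full_left s hsS
    obtain ⟨y, hy, hsy⟩ := h.full_right s hsS
    have mono : ∀ {C : Set V}, (∀ v ∈ C, v ∉ S) → ∀ {u v : V}, v ∈ comp G Cᶜ u →
        v ∈ comp G T u := by
      intro C hC u v huv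
      exact comp_mono (fun p q _ hq hqT => hC q (not_not.1 hq) (hT.1 hqT)) huv
    have h1 : x ∈ comp G T a := mono h.disj_left (h.conn_left a ha x hx)
    have h2 : b ∈ comp G T y := mono h.disj_right (h.conn_right y hy b hb)
    have h3 : y ∈ comp G T x := ReflTransGen.tail
      (ReflTransGen.single ⟨hsx.symm, hsT⟩) ⟨hsy, fun hyT => h.disj_right y hy (hT.1 hyT)⟩
    exact hc (comp_trans h1 (comp_trans h3 h2))

theorem FullPair.mem_minSeparators {G : FinGraph} {A B S : Set G.V}
    (h : FullPair G.graph A B S) : S ∈ G.minSeparators := by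
  obtain ⟨a, ha⟩ := h.nonempty_left
  obtain ⟨b, hb⟩ := h.nonempty_right
  exact ⟨a, b, h.ne ha hb, h.not_adj ha hb, h.isMinSeparatorOf ha hb⟩

/-- At most `K` vertices of `A` suffice to dominate `S`. -/
def Dom (G : SimpleGraph V) (K : ℕ) (A S : Set V) : Prop :=
  ∃ T ⊆ A, T.ncard ≤ K ∧ ∀ s ∈ S, ∃ t ∈ T, G.Adj s t

/-- `N(T)` contains `S` and misses `B`, so the component of `b` in `G - N(T)` is `B`; fullness of
`B` then recovers `S` as `N(B)`. -/
theorem FullPair.eq_nbhd_comp (h : FullPair G A B S) {T : Set V} (hT : T ⊆ A)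
    (hS : ∀ s ∈ S, ∃ t ∈ T, G.Adj s t) {b : V} (hb : b ∈ B) :
    S = nbhd G (comp G (nbhd G T) b) := by
  have hB : comp G (nbhd G T) b = B := by
    apply Set.Subset.antisymm
    · refine comp_subset hb fun x hx y hxy hy => ?_
      refine (h.nbr_right x hx y hxy).resolve_right fun hyS => hy ?_
      obtain ⟨t, ht, hyt⟩ := hS y hyS
      exact ⟨fun hyT => h.disj_left y (hT hyT) hyS, t, ht, hyt.symm⟩
    · intro x hx
      refine comp_mono (fun p q _ hq => ?_) (h.conn_right b hb x hx)
      rintro ⟨-, t, ht, htq⟩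
      exact h.not_adj (hT ht) (not_not.1 hq) htq
  rw [hB]
  ext v
  constructor
  · intro hv
    obtain ⟨b', hb', hvb⟩ := h.full_right v hv
    exact ⟨fun hvB => h.disj_right v hvB hv, b', hb', hvb.symm⟩
  · rintro ⟨hvB, b', hb', hbv⟩
    exact (h.nbr_right b' hb' v hbv).resolve_left hvB

end Components

/-- A nonempty set of at most `K` elements is the range of a function on `Fin K`. -/
theorem exists_range_eq {V : Type} [Finite V] {T : Set V} {K : ℕ} (hne : T.Nonempty)
    (hT : T.ncard ≤ K) : ∃ f : Fin K → V, Set.range f = T := by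
  have hfin : T.Finite := Set.toFinite T
  obtain ⟨t, ht⟩ := hne
  have e := Finite.equivFin T
  rw [Nat.card_coe_set_eq] at e
  refine ⟨fun i => if h : i.1 < T.ncard then (e.symm ⟨i.1, h⟩ : T).1 else t, ?_⟩
  ext v
  constructor
  · rintro ⟨i, rfl⟩
    dsimp only
    split_ifs
    · exact Subtype.coe_prop _
    · exact ht
  · intro hv
    refine ⟨⟨(e ⟨v, hv⟩).1, (e ⟨v, hv⟩).2.trans_le hT⟩, ?_⟩
    simp

/-- Each separator is encoded by a `(K + 1)`-tuple of vertices listing a dominating set, and one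
vertex of the opposite component. This gives the bound `n ^ (K + 2)`. -/
theorem tame_of_dom {C : Set FinGraph} (K : ℕ)
    (h : ∀ G ∈ C, ∀ A B S : Set G.V, FullPair G.graph A B S →
      Dom G.graph K A S ∨ Dom G.graph K B S) : Tame C := by
  refine ⟨Polynomial.X ^ (K + 2), fun G hG => ?_⟩
  let φ : (Fin (K + 1) → G.V) × G.V → Set G.V := fun p =>
    nbhd G.graph (comp G.graph (nbhd G.graph (Set.range p.1)) p.2)
  have key : ∀ A B S : Set G.V, FullPair G.graph A B S → Dom G.graph K A S →
      S ∈ Set.range φ := by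
    rintro A B S hp ⟨T, hTA, hTK, hTS⟩
    obtain ⟨a, ha⟩ := hp.nonempty_left
    obtain ⟨b, hb⟩ := hp.nonempty_right
    -- `T` may be empty when `S` is; adding `a` makes it the range of a tuple, at the cost of one
    -- more entry.
    obtain ⟨f, hf⟩ := exists_range_eq (K := K + 1) (Set.insert_nonempty a T)
      ((Set.ncard_insert_le a T).trans (Nat.succ_le_succ hTK))
    refine ⟨(f, b), ?_⟩
    change nbhd G.graph (comp G.graph (nbhd G.graph (Set.range f)) b) = S
    rw [hf]
    refine (hp.eq_nbhd_comp (Set.insert_subset ha hTA) (fun s hs => ?_) hb).symm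
    obtain ⟨t, ht, hst⟩ := hTS s hs
    exact ⟨t, Set.mem_insert_of_mem _ ht, hst⟩
  have hsub : G.minSeparators ⊆ Set.range φ := by
    rintro S ⟨a, b, -, -, hS⟩
    have hp := exists_fullPair hS
    rcases h G hG _ _ _ hp with hd | hd
    · exact key _ _ _ hp hd
    · exact key _ _ _ hp.symm hd
  have hcard : G.numMinSeparators ≤ G.order ^ (K + 2) := by
    calc G.minSeparators.ncard ≤ (Set.range φ).ncard := Set.ncard_le_ncard hsub (Set.toFinite _)
      _ ≤ Nat.card ((Fin (K + 1) → G.V) × G.V) := by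
        rw [← Set.image_univ, ← Set.ncard_univ]
        exact Set.ncard_image_le (Set.toFinite _)
      _ = G.order ^ (K + 2) := by
        rw [Nat.card_prod, Nat.card_fun, Nat.card_eq_fintype_card (α := Fin (K + 1)),
          Fintype.card_fin]
        rfl
  rw [Polynomial.eval_pow, Polynomial.eval_X]
  exact_mod_cast hcard

theorem Tame.mono {C D : Set FinGraph} (h : C ⊆ D) (hD : Tame D) : Tame C := by
  obtain ⟨p, hp⟩ := hD
  exact ⟨p, fun G hG => hp G (h hG)⟩

end FinGraph

namespace FinGraph

open Relation

/-! ### Four-vertex patterns and their direct effect on full components -/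

section Quad

variable {V : Type} {G : SimpleGraph V} {A B S : Set V}

/-- `G` has four vertices `x, y, z, w` whose adjacencies `xy, xz, xw, yz, yw, zw` are given by
`a, b, c, d, e, f`. -/
def HasQuad (G : SimpleGraph V) (a b c d e f : Bool) : Prop :=
  ∃ x y z w : V, (x ≠ y ∧ x ≠ z ∧ x ≠ w ∧ y ≠ z ∧ y ≠ w ∧ z ≠ w) ∧
    (G.Adj x y ↔ a = true) ∧ (G.Adj x z ↔ b = true) ∧ (G.Adj x w ↔ c = true) ∧
    (G.Adj y z ↔ d = true) ∧ (G.Adj y w ↔ e = true) ∧ (G.Adj z w ↔ f = true)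

/-- These are the eleven graphs on four vertices. The co-diamond is an edge with two isolated
vertices, the co-paw is `P₃ + P₁`, and the co-claw is `K₃ + P₁`. -/
abbrev HasP4 (G : SimpleGraph V) : Prop := HasQuad G true false false true false true
abbrev HasTwoK2 (G : SimpleGraph V) : Prop := HasQuad G true false false false false true
abbrev HasFourP1 (G : SimpleGraph V) : Prop := HasQuad G false false false false false false
abbrev HasCoDiamond (G : SimpleGraph V) : Prop := HasQuad G true false false false false false
abbrev HasCoPaw (G : SimpleGraph V) : Prop := HasQuad G true false false true false false
abbrev HasClaw (G : SimpleGraph V) : Prop := HasQuad G true true true false false false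
abbrev HasCoClaw (G : SimpleGraph V) : Prop := HasQuad G true true false true false false
abbrev HasC4 (G : SimpleGraph V) : Prop := HasQuad G true false true true false true
abbrev HasPaw (G : SimpleGraph V) : Prop := HasQuad G true true true true false false
abbrev HasDiamond (G : SimpleGraph V) : Prop := HasQuad G true true true true true false
abbrev HasK4 (G : SimpleGraph V) : Prop := HasQuad G true true true true true true

theorem dom_of_ncard_le [Finite V] (h : FullPair G A B S) {K : ℕ} (hA : A.ncard ≤ K) :
    Dom G K A S := ⟨A, subset_rfl, hA, h.full_left⟩

/-- Induction along the connected set `A`: a property that holds at one vertex and spreads along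
edges inside `A` holds on all of `A`. -/
theorem FullPair.reflTransGen_left (h : FullPair G A B S) {P : Set V} {a : V} (ha : a ∈ A)
    (haP : a ∈ P) (hP : ∀ x ∈ A, x ∈ P → ∀ y ∈ A, G.Adj x y → y ∈ P) : A ⊆ P := by
  intro v hv
  have : comp G Aᶜ a ⊆ A ∩ P :=
    comp_subset ⟨ha, haP⟩ fun x hx y hxy hy => ⟨not_not.1 hy, hP x hx.1 hx.2 y (not_not.1 hy) hxy⟩
  exact (this (h.conn_left a ha v hv)).2

theorem FullPair.exists_adj_left (h : FullPair G A B S) (hA : ¬ A.ncard ≤ 1) {a : V}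
    (ha : a ∈ A) : ∃ a' ∈ A, G.Adj a a' := by
  by_contra! hno
  have : A ⊆ {a} := h.reflTransGen_left ha rfl fun x _ hxa y hy hxy => by
    obtain rfl : x = a := hxa
    exact absurd hxy (hno y hy)
  exact hA ((Set.ncard_le_ncard this).trans (by simp))

/-- Every `s ∈ S` is adjacent to all of `A`. Otherwise some edge `xy` of `A` has `s` adjacent to `x`
only, and with a neighbour `b ∈ B` of `s` the path `b s x y` is induced. -/
theorem dom_of_not_hasP4 [Finite V] (hP4 : ¬ HasP4 G) (h : FullPair G A B S) :
    Dom G 1 A S := by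
  obtain ⟨a₀, ha₀⟩ := h.nonempty_left
  refine ⟨{a₀}, by simpa using ha₀, by simp, fun s hs => ⟨a₀, rfl, ?_⟩⟩
  obtain ⟨a, ha, hsa⟩ := h.full_left s hs
  obtain ⟨b, hb, hsb⟩ := h.full_right s hs
  have : A ⊆ {x | G.Adj s x} := by
    refine h.reflTransGen_left ha hsa fun x hx hsx y hy hxy => ?_
    by_contra hsy
    have hsx : G.Adj s x := hsx
    have hsy : ¬ G.Adj s y := hsy
    refine hP4 ⟨b, s, x, y, ⟨(h.symm.ne_sep hb hs), (h.ne hx hb).symm, (h.ne hy hb).symm,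
      (h.ne_sep hx hs).symm, (h.ne_sep hy hs).symm, hxy.ne⟩, ?_⟩
    simp [hsb.symm, hsx, hsy, hxy, h.symm.not_adj hb hx, h.symm.not_adj hb hy]
  exact this ha₀

/-- An edge in `A` and an edge in `B` form `2K₂`, so one side is a single vertex. -/
theorem dom_of_not_hasTwoK2 [Finite V] (h2 : ¬ HasTwoK2 G) (h : FullPair G A B S) :
    Dom G 1 A S ∨ Dom G 1 B S := by
  by_cases hA : A.ncard ≤ 1
  · exact Or.inl (dom_of_ncard_le h hA)
  by_cases hB : B.ncard ≤ 1
  · exact Or.inr (dom_of_ncard_le h.symm hB)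
  exfalso
  obtain ⟨a, ha⟩ := h.nonempty_left
  obtain ⟨b, hb⟩ := h.nonempty_right
  obtain ⟨a', ha', haa⟩ := h.exists_adj_left hA ha
  obtain ⟨b', hb', hbb⟩ := h.symm.exists_adj_left hB hb
  refine h2 ⟨a, a', b, b', ⟨haa.ne, h.ne ha hb, h.ne ha hb', h.ne ha' hb, h.ne ha' hb', hbb.ne⟩, ?_⟩
  simp [haa, hbb, h.not_adj ha hb, h.not_adj ha hb', h.not_adj ha' hb, h.not_adj ha' hb']

theorem isClique_of_not_hasCoDiamond [Finite V] (hcd : ¬ HasCoDiamond G) (h : FullPair G A B S)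
    (hB : ¬ B.ncard ≤ 1) : G.IsClique A := by
  intro x hx y hy hxy
  by_contra hadj
  obtain ⟨b, hb⟩ := h.nonempty_right
  obtain ⟨b', hb', hbb⟩ := h.symm.exists_adj_left hB hb
  refine hcd ⟨b, b', x, y, ⟨hbb.ne, (h.ne hx hb).symm, (h.ne hy hb).symm, (h.ne hx hb').symm,
    (h.ne hy hb').symm, hxy⟩, ?_⟩
  simp [hbb, hadj, h.symm.not_adj hb hx, h.symm.not_adj hb hy, h.symm.not_adj hb' hx,
    h.symm.not_adj hb' hy]

/-- A connected graph that is not complete has an induced `P₃`; a vertex of `B` completes it to a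
co-paw. -/
theorem isClique_of_not_hasCoPaw (hcp : ¬ HasCoPaw G) (h : FullPair G A B S) :
    G.IsClique A := by
  intro x hx y hy hxy
  obtain ⟨b, hb⟩ := h.nonempty_right
  have : A ⊆ {v | v = x ∨ G.Adj x v} := by
    refine h.reflTransGen_left hx (Or.inl rfl) ?_
    rintro u hu (rfl | hxu) v hv huv
    · exact Or.inr huv
    · by_contra hcon
      obtain ⟨hvx, hxv⟩ := not_or.1 hcon
      refine hcp ⟨x, u, v, b, ⟨hxu.ne, Ne.symm hvx, h.ne hx hb, huv.ne, h.ne hu hb, h.ne hv hb⟩, ?_⟩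
      simp [hxu, hxv, huv, h.not_adj hx hb, h.not_adj hu hb, h.not_adj hv hb]
  exact (this hy).resolve_left hxy.symm

theorem exists_adj_of_not_hasFourP1 (h4 : ¬ HasFourP1 G) (h : FullPair G A B S) {x y z : V}
    (hx : x ∈ A) (hy : y ∈ A) (hz : z ∈ A) (hxy : x ≠ y) (hxz : x ≠ z) (hyz : y ≠ z) :
    G.Adj x y ∨ G.Adj x z ∨ G.Adj y z := by
  by_contra! hno
  obtain ⟨b, hb⟩ := h.nonempty_right
  refine h4 ⟨x, y, z, b, ⟨hxy, hxz, h.ne hx hb, hyz, h.ne hy hb, h.ne hz hb⟩, ?_⟩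
  simp [hno, h.not_adj hx hb, h.not_adj hy hb, h.not_adj hz hb]

/-- A Ramsey bound. For a vertex `a`, the neighbours of `a` have smaller cliques, and the
non-neighbours form a clique because there is no independent triple. -/
theorem card_le_of_clique_le {A : Set V} [Finite V]
    (hA : ∀ x ∈ A, ∀ y ∈ A, ∀ z ∈ A, x ≠ y → x ≠ z → y ≠ z →
      G.Adj x y ∨ G.Adj x z ∨ G.Adj y z) (k : ℕ)
    (hk : ∀ T ⊆ A, G.IsClique T → T.ncard ≤ k) : A.ncard ≤ (k + 1) ^ 2 := by
  induction k generalizing A with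
  | zero =>
    rcases A.eq_empty_or_nonempty with rfl | ⟨a, ha⟩
    · simp
    · have := hk {a} (by simpa using ha) (by simp)
      simp at this
  | succ k ih =>
    rcases A.eq_empty_or_nonempty with rfl | ⟨a, ha⟩
    · simp
    have h1 : (A ∩ {v | G.Adj a v}).ncard ≤ (k + 1) ^ 2 := by
      refine ih (fun x hx y hy z hz => hA x hx.1 y hy.1 z hz.1) fun T hT hcl => ?_
      have haT : a ∉ T := fun h => G.irrefl (hT h).2
      have := hk (insert a T) (Set.insert_subset ha fun t ht => (hT ht).1)
        (hcl.insert fun t ht _ => (hT ht).2)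
      rw [Set.ncard_insert_of_notMem haT] at this
      omega
    have h2 : (A \ {v | v = a ∨ G.Adj a v}).ncard ≤ k + 1 := by
      refine hk _ Set.sdiff_subset fun x hx y hy hxy => ?_
      have hxa := not_or.1 hx.2
      have hya := not_or.1 hy.2
      rcases hA a ha x hx.1 y hy.1 (Ne.symm hxa.1) (Ne.symm hya.1) hxy with h | h | h
      · exact absurd h hxa.2
      · exact absurd h hya.2
      · exact h
    have hsub : A ⊆ {a} ∪ ((A ∩ {v | G.Adj a v}) ∪ (A \ {v | v = a ∨ G.Adj a v})) := by
      intro v hv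
      by_cases hva : v = a
      · exact Or.inl hva
      by_cases hav : G.Adj a v
      · exact Or.inr (Or.inl ⟨hv, hav⟩)
      · exact Or.inr (Or.inr ⟨hv, fun h => h.elim hva hav⟩)
    have h3 := (Set.ncard_le_ncard hsub (Set.toFinite _)).trans ((Set.ncard_union_le _ _).trans
      (Nat.add_le_add_left (Set.ncard_union_le _ _) _))
    rw [Set.ncard_singleton] at h3
    nlinarith

theorem exists_four_of_ncard [Finite V] {T : Set V} (hT : ¬ T.ncard ≤ 3) :
    ∃ x ∈ T, ∃ y ∈ T, ∃ z ∈ T, ∃ w ∈ T, x ≠ y ∧ x ≠ z ∧ x ≠ w ∧ y ≠ z ∧ y ≠ w ∧ z ≠ w := by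
  have e := Finite.equivFin T
  rw [Nat.card_coe_set_eq] at e
  have hlt : ∀ i : Fin 4, i.1 < T.ncard := fun i => by omega
  have hne : ∀ i j : Fin 4, i ≠ j → (e.symm ⟨i, hlt i⟩).1 ≠ (e.symm ⟨j, hlt j⟩).1 := by
    intro i j hij h
    exact hij (Fin.ext (by simpa using e.symm.injective (Subtype.ext h)))
  exact ⟨_, (e.symm ⟨_, hlt 0⟩).2, _, (e.symm ⟨_, hlt 1⟩).2, _, (e.symm ⟨_, hlt 2⟩).2,
    _, (e.symm ⟨_, hlt 3⟩).2, hne 0 1 (by decide), hne 0 2 (by decide), hne 0 3 (by decide),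
    hne 1 2 (by decide), hne 1 3 (by decide), hne 2 3 (by decide)⟩

/-- Every clique in `A` has at most three vertices. -/
def CliqueLE (G : SimpleGraph V) (A : Set V) : Prop := ∀ T ⊆ A, G.IsClique T → T.ncard ≤ 3

theorem cliqueLE_of_not_hasK4 [Finite V] (hK : ¬ HasK4 G) (A : Set V) : CliqueLE G A := by
  intro T _ hcl
  by_contra hT
  obtain ⟨x, hx, y, hy, z, hz, w, hw, hxy, hxz, hxw, hyz, hyw, hzw⟩ := exists_four_of_ncard hT
  refine hK ⟨x, y, z, w, ⟨hxy, hxz, hxw, hyz, hyw, hzw⟩, ?_⟩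
  simp [hcl hx hy hxy, hcl hx hz hxz, hcl hx hw hxw, hcl hy hz hyz, hcl hy hw hyw, hcl hz hw hzw]

theorem cliqueLE_of_triangleFree [Finite V]
    (hA : ∀ x ∈ A, ∀ y ∈ A, ∀ z ∈ A, G.Adj x y → G.Adj x z → ¬ G.Adj y z) : CliqueLE G A := by
  intro T hTA hcl
  by_contra hT
  obtain ⟨x, hx, y, hy, z, hz, w, hw, hxy, hxz, hxw, hyz, hyw, hzw⟩ := exists_four_of_ncard hT
  exact hA x (hTA hx) y (hTA hy) z (hTA hz) (hcl hx hy hxy) (hcl hx hz hxz) (hcl hy hz hyz)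

theorem triangleFree_of_not_hasCoClaw (hcc : ¬ HasCoClaw G) (h : FullPair G A B S) :
    ∀ x ∈ A, ∀ y ∈ A, ∀ z ∈ A, G.Adj x y → G.Adj x z → ¬ G.Adj y z := by
  intro x hx y hy z hz hxy hxz hyz
  obtain ⟨b, hb⟩ := h.nonempty_right
  refine hcc ⟨x, y, z, b, ⟨hxy.ne, hxz.ne, h.ne hx hb, hyz.ne, h.ne hy hb, h.ne hz hb⟩, ?_⟩
  simp [hxy, hxz, hyz, h.not_adj hx hb, h.not_adj hy hb, h.not_adj hz hb]

end Quad
end FinGraph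

namespace FinGraph

open Relation

/-! ### Dominating the separator from one side -/

section Combinatorics

variable {V : Type} {G : SimpleGraph V} {A B S : Set V}

theorem adj_of_not_hasPaw (hp : ¬ HasPaw G) {x y z w : V} (hxy : G.Adj x y) (hxz : G.Adj x z)
    (hyz : G.Adj y z) (hxw : G.Adj x w) (hwy : w ≠ y) (hwz : w ≠ z) :
    G.Adj y w ∨ G.Adj z w := by
  by_contra! hno
  refine hp ⟨x, y, z, w, ⟨hxy.ne, hxz.ne, hxw.ne, hyz.ne, hwy.symm, hwz.symm⟩, ?_⟩
  simp [hxy, hxz, hyz, hxw, hno]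

theorem adj_of_not_hasClaw (hc : ¬ HasClaw G) {x y z w : V} (hxy : G.Adj x y) (hxz : G.Adj x z)
    (hxw : G.Adj x w) (hyz : y ≠ z) (hyw : y ≠ w) (hzw : z ≠ w) :
    G.Adj y z ∨ G.Adj y w ∨ G.Adj z w := by
  by_contra! hno
  refine hc ⟨x, y, z, w, ⟨hxy.ne, hxz.ne, hxw.ne, hyz, hyw, hzw⟩, ?_⟩
  simp [hxy, hxz, hxw, hno]

/-- A triangle `s x y` would form a paw with a neighbour of `s` in `B`. -/
theorem no_triangle_of_not_hasPaw (hp : ¬ HasPaw G) (h : FullPair G A B S) {s x y : V}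
    (hs : s ∈ S) (hx : x ∈ A) (hy : y ∈ A) (hsx : G.Adj s x) (hsy : G.Adj s y) :
    ¬ G.Adj x y := by
  intro hxy
  obtain ⟨b, hb, hsb⟩ := h.full_right s hs
  rcases adj_of_not_hasPaw hp hsx hsy hxy hsb (h.ne hx hb).symm (h.ne hy hb).symm with h' | h'
  · exact h.not_adj hx hb h'
  · exact h.not_adj hy hb h'

/-- In a paw-free graph, lying in a triangle of `A` spreads along edges of `A`, so it reaches a
neighbour `a` of some `s ∈ S`. Paw-freeness at `a` then makes `s` adjacent to a second vertex of
that triangle, against `no_triangle_of_not_hasPaw`. -/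
theorem triangleFree_of_not_hasPaw (hp : ¬ HasPaw G) (h : FullPair G A B S) (hS : S.Nonempty) :
    ∀ x ∈ A, ∀ y ∈ A, ∀ z ∈ A, G.Adj x y → G.Adj x z → ¬ G.Adj y z := by
  intro x hx y hy z hz hxy hxz hyz
  obtain ⟨s, hs⟩ := hS
  obtain ⟨a, ha, hsa⟩ := h.full_left s hs
  have key : A ⊆ {v | ∃ y ∈ A, ∃ z ∈ A, G.Adj v y ∧ G.Adj v z ∧ G.Adj y z} := by
    refine h.reflTransGen_left hx ⟨y, hy, z, hz, hxy, hxz, hyz⟩ ?_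
    rintro u hu ⟨p, hpA, q, hq, hup, huq, hpq⟩ v hv huv
    by_cases hvp : v = p
    · subst hvp; exact ⟨u, hu, q, hq, hup.symm, hpq, huq⟩
    by_cases hvq : v = q
    · subst hvq; exact ⟨u, hu, p, hpA, huq.symm, hpq.symm, hup⟩
    rcases adj_of_not_hasPaw hp hup huq hpq huv hvp hvq with h' | h'
    · exact ⟨u, hu, p, hpA, huv.symm, h'.symm, hup⟩
    · exact ⟨u, hu, q, hq, huv.symm, h'.symm, huq⟩
  obtain ⟨p, hpA, q, hq, hap, haq, hpq⟩ := key ha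
  rcases adj_of_not_hasPaw hp hap haq hpq hsa.symm (h.ne_sep hpA hs).symm
    (h.ne_sep hq hs).symm with h' | h'
  · exact no_triangle_of_not_hasPaw hp h hs ha hpA hsa h'.symm hap
  · exact no_triangle_of_not_hasPaw hp h hs ha hq hsa h'.symm haq

/-- A connected graph has at least `|V| - 1` edges, so its degrees sum to at least `2|V| - 2`: the
total deficiency from degree two is at most two. -/
theorem ncard_degree_le_one_le [Finite V] (hG : G.Connected)
    (hdeg : ∀ v, (G.neighborSet v).ncard ≤ 2) :
    {v | (G.neighborSet v).ncard ≤ 1}.ncard ≤ 2 := by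
  classical
  have := Fintype.ofFinite V
  have hd : ∀ v, (G.neighborSet v).ncard = G.degree v := fun v => by
    rw [Set.ncard_eq_toFinset_card', Set.toFinset_card, SimpleGraph.card_neighborSet_eq_degree]
  have h1 := hG.card_vert_le_card_edgeSet_add_one
  rw [Nat.card_eq_fintype_card, Nat.card_eq_fintype_card, ← SimpleGraph.edgeFinset_card] at h1
  have h2 := G.sum_degrees_eq_twice_card_edges
  have h3 : ∑ v, (G.degree v + if G.degree v ≤ 1 then 1 else 0) ≤ ∑ _v : V, 2 := by
    refine Finset.sum_le_sum fun v _ => ?_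
    have := hdeg v
    rw [hd] at this
    split_ifs <;> omega
  rw [Finset.sum_add_distrib, h2, Finset.sum_const, Finset.card_univ, ← Finset.card_filter,
    smul_eq_mul] at h3
  simp only [hd]
  rw [Set.ncard_eq_toFinset_card', Set.toFinset_ofPred]
  omega

theorem FullPair.connected_left (h : FullPair G A B S) : (G.induce A).Connected := by
  obtain ⟨Z, rfl⟩ : ∃ Z : Set V, A = Zᶜ := ⟨Aᶜ, (compl_compl A).symm⟩
  have hconn := h.conn_left
  rw [compl_compl] at hconn
  obtain ⟨a, ha⟩ := h.nonempty_left
  have : Nonempty (Zᶜ : Set V) := ⟨⟨a, ha⟩⟩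
  exact ⟨fun x y => (reachable_induce_iff x.2 y.2).2 (hconn x x.2 y y.2)⟩

theorem ncard_neighborSet_induce (A : Set V) (a : A) :
    ((G.induce A).neighborSet a).ncard = (A ∩ {v | G.Adj a v}).ncard := by
  have : (A ∩ {v | G.Adj a v}) = Subtype.val '' ((G.induce A).neighborSet a) := by
    ext v
    constructor
    · rintro ⟨hv, hav⟩
      exact ⟨⟨v, hv⟩, hav, rfl⟩
    · rintro ⟨w, hw, rfl⟩
      exact ⟨w.2, hw⟩
  rw [this, Set.ncard_image_of_injective _ Subtype.val_injective]

/-- Without claws and triangles, `G[A]` has maximum degree two. A vertex of `A` with a neighbour `s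
∈ S` has at most one neighbour in `A`, as two would form a claw with `s`. So at most two vertices of
`A` have neighbours in `S`, and these dominate `S`. -/
theorem dom_of_not_hasClaw [Finite V] (hc : ¬ HasClaw G) (h : FullPair G A B S)
    (htri : ∀ x ∈ A, ∀ y ∈ A, ∀ z ∈ A, G.Adj x y → G.Adj x z → ¬ G.Adj y z)
    (hstri : ∀ s ∈ S, ∀ x ∈ A, ∀ y ∈ A, G.Adj s x → G.Adj s y → ¬ G.Adj x y) :
    Dom G 2 A S := by
  refine ⟨{a ∈ A | ∃ s ∈ S, G.Adj s a}, Set.sep_subset _ _, ?_, fun s hs => ?_⟩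
  swap
  · obtain ⟨a, ha, hsa⟩ := h.full_left s hs
    exact ⟨a, ⟨ha, s, hs, hsa⟩, hsa⟩
  have hsub : {a ∈ A | ∃ s ∈ S, G.Adj s a} ⊆
      Subtype.val '' {v : A | ((G.induce A).neighborSet v).ncard ≤ 1} := by
    rintro a ⟨ha, s, hs, hsa⟩
    refine ⟨⟨a, ha⟩, ?_, rfl⟩
    rw [Set.mem_ofPred_eq, ncard_neighborSet_induce, Set.ncard_le_one_iff]
    rintro x y ⟨hx, hax⟩ ⟨hy, hay⟩
    by_contra hxy
    rcases adj_of_not_hasClaw hc hsa.symm hax hay (h.ne_sep hx hs).symm (h.ne_sep hy hs).symm hxy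
      with h' | h' | h'
    · exact hstri s hs a ha x hx hsa h' hax
    · exact hstri s hs a ha y hy hsa h' hay
    · exact htri a ha x hx y hy hax hay h'
  have hle : {v : A | ((G.induce A).neighborSet v).ncard ≤ 1}.ncard ≤ 2 := by
    refine ncard_degree_le_one_le h.connected_left fun v => ?_
    rw [ncard_neighborSet_induce]
    by_contra hlt
    obtain ⟨x, y, z, ⟨hx, hvx⟩, ⟨hy, hvy⟩, ⟨hz, hvz⟩, hxy, hxz, hyz⟩ :=
      (Set.two_lt_ncard_iff).1 (not_le.1 hlt)
    rcases adj_of_not_hasClaw hc hvx hvy hvz hxy hxz hyz with h' | h' | h'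
    · exact htri v v.2 x hx y hy hvx hvy h'
    · exact htri v v.2 x hx z hz hvx hvz h'
    · exact htri v v.2 y hy z hz hvy hvz h'
  calc _ ≤ _ := Set.ncard_le_ncard hsub (Set.toFinite _)
    _ ≤ _ := Set.ncard_image_le (Set.toFinite _)
    _ ≤ 2 := hle

theorem dom_of_not_hasClaw_of_not_hasPaw [Finite V] (hc : ¬ HasClaw G) (hp : ¬ HasPaw G)
    (h : FullPair G A B S) : Dom G 2 A S := by
  rcases S.eq_empty_or_nonempty with rfl | hS
  · exact ⟨∅, Set.empty_subset _, by simp, by simp⟩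
  · exact dom_of_not_hasClaw hc h (triangleFree_of_not_hasPaw hp h hS)
      fun s hs x hx y hy => no_triangle_of_not_hasPaw hp h hs hx hy

/-- Suppose `s` lies in a triangle with `x, y ∈ A`. Co-claw-freeness makes `s` adjacent to all of
`B`, and claw-freeness at `s` then makes `B` a clique. Three vertices of `B` thus form a triangle,
which is a co-claw together with a vertex of `A`. -/
theorem dom_of_not_hasClaw_of_not_hasCoClaw [Finite V] (hc : ¬ HasClaw G) (hcc : ¬ HasCoClaw G)
    (h : FullPair G A B S) : Dom G 2 A S ∨ Dom G 2 B S := by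
  by_cases hB : B.ncard ≤ 2
  · exact Or.inr (dom_of_ncard_le h.symm hB)
  refine Or.inl (dom_of_not_hasClaw hc h (triangleFree_of_not_hasCoClaw hcc h) ?_)
  intro s hs x hx y hy hsx hsy hxy
  have hall : ∀ b ∈ B, G.Adj s b := by
    intro b hb
    by_contra hsb
    refine hcc ⟨s, x, y, b, ⟨hsx.ne, hsy.ne, (h.symm.ne_sep hb hs).symm, hxy.ne, h.ne hx hb,
      h.ne hy hb⟩, ?_⟩
    simp [hsx, hsy, hxy, hsb, h.not_adj hx hb, h.not_adj hy hb]
  have hcl : ∀ b ∈ B, ∀ b' ∈ B, b ≠ b' → G.Adj b b' := by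
    intro b hb b' hb' hbb
    rcases adj_of_not_hasClaw hc hsx (hall b hb) (hall b' hb') (h.ne hx hb) (h.ne hx hb') hbb
      with h' | h' | h'
    · exact absurd h' (h.not_adj hx hb)
    · exact absurd h' (h.not_adj hx hb')
    · exact h'
  obtain ⟨p, q, r, hp, hq, hr, hpq, hpr, hqr⟩ := (Set.two_lt_ncard_iff).1 (not_le.1 hB)
  exact triangleFree_of_not_hasCoClaw hcc h.symm p hp q hq r hr (hcl p hp q hq hpq)
    (hcl p hp r hr hpr) (hcl q hq r hr hqr)

/-- In a `C₄`-free graph, two non-adjacent vertices of `S` do not have common neighbours on both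
sides. -/
theorem no_common_of_not_hasC4 (h4 : ¬ HasC4 G) (h : FullPair G A B S) {s t a b : V}
    (hst : ¬ G.Adj s t) (hne : s ≠ t) (ha : a ∈ A) (hb : b ∈ B) (hsa : G.Adj s a)
    (hta : G.Adj t a) (hsb : G.Adj s b) (htb : G.Adj t b) : False := by
  refine h4 ⟨s, a, t, b, ⟨hsa.ne, hne, hsb.ne, hta.ne.symm, h.ne ha hb, htb.ne⟩, ?_⟩
  simp [hsa, hst, hsb, hta.symm, h.not_adj ha hb, htb]

/-- Adjacent vertices of `S` have nested neighbourhoods in the clique `A`, since otherwise a `C₄`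
appears. Take `s₀` with fewest neighbours in `A`, and `a₀` any one of them. -/
theorem exists_dominating_nbr [Finite V] (h4 : ¬ HasC4 G) (h : FullPair G A B S)
    (hA : G.IsClique A) {U : Set V} (hU : U ⊆ S) (hne : U.Nonempty) :
    ∃ s₀ ∈ U, ∃ a₀ ∈ A, ∀ s ∈ U, s = s₀ ∨ G.Adj s s₀ → G.Adj s a₀ := by
  obtain ⟨s₀, hs₀, hmin⟩ := Set.exists_min_image U (fun s => (A ∩ {a | G.Adj s a}).ncard)
    (Set.toFinite U) hne
  obtain ⟨a₀, ha₀, hsa₀⟩ := h.full_left s₀ (hU hs₀)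
  refine ⟨s₀, hs₀, a₀, ha₀, ?_⟩
  rintro s hs (rfl | hss)
  · exact hsa₀
  by_contra hsa
  have hsub : A ∩ {a | G.Adj s a} ⊆ A ∩ {a | G.Adj s₀ a} := by
    rintro a ⟨ha, hsa'⟩
    refine ⟨ha, ?_⟩
    by_contra hs₀a
    have hsa' : G.Adj s a := hsa'
    have hs₀a : ¬ G.Adj s₀ a := hs₀a
    have hne : a ≠ a₀ := by rintro rfl; exact hsa hsa'
    have haa : G.Adj a a₀ := hA ha ha₀ hne
    refine h4 ⟨s, a, a₀, s₀, ⟨hsa'.ne, (h.ne_sep ha₀ (hU hs)).symm, hss.ne, hne,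
      h.ne_sep ha (hU hs₀), hsa₀.ne.symm⟩, ?_⟩
    simp [hsa', hsa, hss, haa, hsa₀.symm, mt SimpleGraph.Adj.symm hs₀a]
  have hlt := Set.ncard_lt_ncard (ht := Set.toFinite _)
    (Set.ssubset_iff_of_subset hsub |>.2 ⟨a₀, ⟨ha₀, hsa₀⟩, fun h => hsa h.2⟩)
  exact absurd (hmin s hs) (not_le.2 hlt)

theorem dom_of_isClique_of_not_hasC4 [Finite V] (h4 : ¬ HasC4 G) (h : FullPair G A B S)
    (hA : G.IsClique A)
    (hS : ∀ s ∈ S, ∀ t ∈ S, ∀ u ∈ S, s ≠ t → s ≠ u → t ≠ u →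
      G.Adj s t ∨ G.Adj s u ∨ G.Adj t u) : Dom G 2 A S := by
  rcases S.eq_empty_or_nonempty with rfl | hne
  · exact ⟨∅, Set.empty_subset _, by simp, by simp⟩
  obtain ⟨s₁, hs₁, a₁, ha₁, h₁⟩ := exists_dominating_nbr h4 h hA subset_rfl hne
  rcases Set.eq_empty_or_nonempty {s ∈ S | ¬ (s = s₁ ∨ G.Adj s s₁)} with he | hne
  · refine ⟨{a₁}, by simpa using ha₁, by simp, fun s hs => ⟨a₁, rfl, h₁ s hs ?_⟩⟩
    by_contra hcon
    exact Set.notMem_empty s (he ▸ ⟨hs, hcon⟩)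
  -- The vertices missed by `s₁` are pairwise adjacent, as `S` has no independent triple, so one
  -- more vertex `a₂` dominates all of them.
  · obtain ⟨s₂, hs₂, a₂, ha₂, h₂⟩ := exists_dominating_nbr h4 h hA (Set.sep_subset _ _) hne
    refine ⟨{a₁, a₂}, Set.insert_subset ha₁ (by simpa using ha₂),
      (Set.ncard_insert_le _ _).trans (by simp),
      fun s hs => ?_⟩
    by_cases hc : s = s₁ ∨ G.Adj s s₁
    · exact ⟨a₁, by simp, h₁ s hs hc⟩
    · refine ⟨a₂, by simp, h₂ s ⟨hs, hc⟩ ?_⟩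
      by_contra hcon
      have hc := not_or.1 hc
      have hcon := not_or.1 hcon
      have hc₂ := not_or.1 hs₂.2
      rcases hS s hs s₂ hs₂.1 s₁ hs₁ hcon.1 hc.1 hc₂.1 with h' | h' | h'
      · exact hcon.2 h'
      · exact hc.2 h'
      · exact hc₂.2 h'

theorem adj_of_not_hasCoDiamond (hcd : ¬ HasCoDiamond G) (h : FullPair G A B S) {s t u : V}
    (hs : s ∈ S) (ht : t ∈ S) (hu : u ∈ S) (hst : ¬ G.Adj s t) (hsu : ¬ G.Adj s u)
    (htu : ¬ G.Adj t u) (hst' : s ≠ t) (hsu' : s ≠ u) (htu' : t ≠ u) :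
    ∃ a ∈ A, G.Adj s a ∧ (G.Adj t a ∨ G.Adj u a) := by
  obtain ⟨a, ha, hsa⟩ := h.full_left s hs
  refine ⟨a, ha, hsa, ?_⟩
  by_contra! hno
  refine hcd ⟨s, a, t, u, ⟨hsa.ne, hst', hsu', h.ne_sep ha ht, h.ne_sep ha hu, htu'⟩, ?_⟩
  simp [hsa, hst, hsu, htu, G.adj_comm a, hno]

/-- For an independent triple in `S`, co-diamond-freeness makes each vertex share a neighbour in `A`
with another one, so at least two of the three pairs have common neighbours in `A`. The same holds
in `B`, so some pair has them on both sides, giving a `C₄`. -/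
theorem sep_adj_of_not_hasCoDiamond (h4 : ¬ HasC4 G) (hcd : ¬ HasCoDiamond G)
    (h : FullPair G A B S) : ∀ s ∈ S, ∀ t ∈ S, ∀ u ∈ S, s ≠ t → s ≠ u → t ≠ u →
      G.Adj s t ∨ G.Adj s u ∨ G.Adj t u := by
  intro s hs t ht u hu hst' hsu' htu'
  by_contra! ⟨hst, hsu, htu⟩
  have hts := mt SimpleGraph.Adj.symm hst
  have hus := mt SimpleGraph.Adj.symm hsu
  have hut := mt SimpleGraph.Adj.symm htu
  have key : ∀ {A B : Set V}, FullPair G A B S →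
      ((∃ a ∈ A, G.Adj s a ∧ G.Adj t a) ∨ (∃ a ∈ A, G.Adj s a ∧ G.Adj u a)) ∧
      ((∃ a ∈ A, G.Adj s a ∧ G.Adj t a) ∨ (∃ a ∈ A, G.Adj t a ∧ G.Adj u a)) ∧
      ((∃ a ∈ A, G.Adj s a ∧ G.Adj u a) ∨ (∃ a ∈ A, G.Adj t a ∧ G.Adj u a)) := by
    intro A B h
    obtain ⟨a, ha, h1, h1'⟩ := adj_of_not_hasCoDiamond hcd h hs ht hu hst hsu htu hst' hsu' htu'
    obtain ⟨b, hb, h2, h2'⟩ := adj_of_not_hasCoDiamond hcd h ht hs hu hts htu hsu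
      hst'.symm htu' hsu'
    obtain ⟨c, hc, h3, h3'⟩ := adj_of_not_hasCoDiamond hcd h hu hs ht hus hut hst
      hsu'.symm htu'.symm hst'
    refine ⟨?_, ?_, ?_⟩
    · exact h1'.imp (fun h' => ⟨a, ha, h1, h'⟩) (fun h' => ⟨a, ha, h1, h'⟩)
    · exact h2'.imp (fun h' => ⟨b, hb, h', h2⟩) (fun h' => ⟨b, hb, h2, h'⟩)
    · exact h3'.imp (fun h' => ⟨c, hc, h', h3⟩) (fun h' => ⟨c, hc, h', h3⟩)
  have common : ∀ {p q : V}, ¬ G.Adj p q → p ≠ q → (∃ a ∈ A, G.Adj p a ∧ G.Adj q a) →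
      ¬ ∃ b ∈ B, G.Adj p b ∧ G.Adj q b := by
    rintro p q hpq hne ⟨a, ha, hpa, hqa⟩ ⟨b, hb, hpb, hqb⟩
    exact no_common_of_not_hasC4 h4 h hpq hne ha hb hpa hqa hpb hqb
  obtain ⟨kA₁, kA₂, kA₃⟩ := key h
  obtain ⟨kB₁, kB₂, kB₃⟩ := key h.symm
  have c1 := common hst hst'
  have c2 := common hsu hsu'
  have c3 := common htu htu'
  clear key common
  rcases kA₁ with h1 | h1
  · have hB₁ := kB₁.resolve_left (c1 h1)
    have hB₂ := kB₂.resolve_left (c1 h1)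
    exact kA₃.elim (fun h' => c2 h' hB₁) (fun h' => c3 h' hB₂)
  · have hB₁ := kB₁.resolve_right (c2 h1)
    have hB₃ := kB₃.resolve_left (c2 h1)
    exact kA₂.elim (fun h' => c1 h' hB₁) (fun h' => c3 h' hB₃)

/-- For an independent triple `s, t, u`, the vertices `s` and `t` have a common neighbour on each
side, giving a `C₄`. Otherwise take neighbours `a` of `s` and `b` of `t` in the clique: a further
edge `ua` gives the co-paw `s a u` plus `t`, symmetrically for `ub`, and without both edges `s a b`
plus `u` is a co-paw. -/
theorem sep_adj_of_not_hasCoPaw (h4 : ¬ HasC4 G) (hcp : ¬ HasCoPaw G)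
    (h : FullPair G A B S) (hA : G.IsClique A) (hB : G.IsClique B) :
    ∀ s ∈ S, ∀ t ∈ S, ∀ u ∈ S, s ≠ t → s ≠ u → t ≠ u →
      G.Adj s t ∨ G.Adj s u ∨ G.Adj t u := by
  intro s hs t ht u hu hst' hsu' htu'
  by_contra! ⟨hst, hsu, htu⟩
  have hts := mt SimpleGraph.Adj.symm hst
  have key : ∀ {A B : Set V}, FullPair G A B S → G.IsClique A →
      ∃ a ∈ A, G.Adj s a ∧ G.Adj t a := by
    intro A B h hA
    by_contra! hno
    have hpriv : ∀ {p q r a : V}, p ∈ S → q ∈ S → r ∈ S → ¬ G.Adj p q → ¬ G.Adj p r →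
        ¬ G.Adj q r → p ≠ q → p ≠ r → q ≠ r →
        a ∈ A → G.Adj p a → ¬ G.Adj q a → ¬ G.Adj r a := by
      intro p q r a hp hq hr hpq hpr hqr hpq' hpr' hqr' ha hpa hqa hra
      refine hcp ⟨p, a, r, q, ⟨hpa.ne, hpr', hpq', h.ne_sep ha hr, h.ne_sep ha hq, hqr'.symm⟩, ?_⟩
      simp [hpa, hpr, hpq, hra.symm, mt SimpleGraph.Adj.symm hqa, mt SimpleGraph.Adj.symm hqr]
    obtain ⟨a, ha, hsa⟩ := h.full_left s hs
    obtain ⟨b, hb, htb⟩ := h.full_left t ht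
    have hta := hno a ha hsa
    have hsb : ¬ G.Adj s b := fun h' => hno b hb h' htb
    have hua := hpriv hs ht hu hst hsu htu hst' hsu' htu' ha hsa hta
    have hub := hpriv ht hs hu hts htu hsu hst'.symm htu' hsu' hb htb hsb
    have hab : a ≠ b := by rintro rfl; exact hta htb
    refine hcp ⟨s, a, b, u, ⟨hsa.ne, (h.ne_sep hb hs).symm, hsu', hab, h.ne_sep ha hu,
      h.ne_sep hb hu⟩, ?_⟩
    simp [hsa, hsb, hsu, hA ha hb hab, mt SimpleGraph.Adj.symm hua, mt SimpleGraph.Adj.symm hub]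
  obtain ⟨a, ha, hsa, hta⟩ := key h hA
  obtain ⟨b, hb, hsb, htb⟩ := key h.symm hB
  exact no_common_of_not_hasC4 h4 h hst hst' ha hb hsa hta hsb htb

/-- Fix `b₀ ∈ B`. By diamond-freeness, a vertex of `S` not adjacent to `b₀` has just one neighbour
in the clique `B`. Two such vertices with different neighbours are non-adjacent, by `C₄`-freeness.
Hence `4P₁`-freeness allows at most three of these neighbours besides `b₀`. -/
theorem dom_right_of_not_hasDiamond [Finite V] (h4 : ¬ HasFourP1 G) (hC : ¬ HasC4 G)
    (hd : ¬ HasDiamond G) (h : FullPair G A B S) (hB : G.IsClique B) : Dom G 4 B S := by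
  by_cases hB2 : B.ncard ≤ 2
  · exact dom_of_ncard_le h.symm (hB2.trans (by norm_num))
  obtain ⟨b₀, hb₀⟩ := h.nonempty_right
  have huniq : ∀ s ∈ S, ¬ G.Adj s b₀ → ∀ b ∈ B, ∀ b' ∈ B, G.Adj s b → G.Adj s b' → b = b' := by
    intro s hs hsb₀ b hb b' hb' hsb hsb'
    by_contra hne
    have h1 : b ≠ b₀ := by rintro rfl; exact hsb₀ hsb
    have h2 : b' ≠ b₀ := by rintro rfl; exact hsb₀ hsb'
    refine hd ⟨b, b', s, b₀, ⟨hne, h.symm.ne_sep hb hs, h1, h.symm.ne_sep hb' hs, h2,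
      (h.symm.ne_sep hb₀ hs).symm⟩, ?_⟩
    simp [hB hb hb' hne, hsb.symm, hB hb hb₀ h1, hsb'.symm, hB hb' hb₀ h2, hsb₀]
  set T : Set V := {b ∈ B | ∃ s ∈ S, ¬ G.Adj s b₀ ∧ G.Adj s b} with hT
  have hT3 : T.ncard ≤ 3 := by
    by_contra hcon
    obtain ⟨x, ⟨hx, p, hp, hp0, hpx⟩, y, ⟨hy, q, hq, hq0, hqy⟩, z, ⟨hz, r, hr, hr0, hrz⟩,
      w, ⟨hw, t, ht, ht0, htw⟩, hxy, hxz, hxw, hyz, hyw, hzw⟩ := exists_four_of_ncard hcon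
    have key : ∀ {p q x y : V}, p ∈ S → q ∈ S → x ∈ B → y ∈ B → ¬ G.Adj p b₀ → ¬ G.Adj q b₀ →
        G.Adj p x → G.Adj q y → x ≠ y → p ≠ q ∧ ¬ G.Adj p q := by
      intro p q x y hp hq hx hy hp0 hq0 hpx hqy hxy
      have hpy : ¬ G.Adj p y := fun h' => hxy (huniq p hp hp0 x hx y hy hpx h')
      have hqx : ¬ G.Adj q x := fun h' => hxy (huniq q hq hq0 x hx y hy h' hqy)
      refine ⟨by rintro rfl; exact hpy hqy, fun hpq => ?_⟩
      refine hC ⟨p, x, y, q, ⟨hpx.ne, (h.symm.ne_sep hy hp).symm, hpq.ne, hxy,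
        h.symm.ne_sep hx hq, hqy.ne.symm⟩, ?_⟩
      simp [hpx, hpy, hpq, hB hx hy hxy, mt SimpleGraph.Adj.symm hqx, hqy.symm]
    have k1 := key hp hq hx hy hp0 hq0 hpx hqy hxy
    have k2 := key hp hr hx hz hp0 hr0 hpx hrz hxz
    have k3 := key hp ht hx hw hp0 ht0 hpx htw hxw
    have k4 := key hq hr hy hz hq0 hr0 hqy hrz hyz
    have k5 := key hq ht hy hw hq0 ht0 hqy htw hyw
    have k6 := key hr ht hz hw hr0 ht0 hrz htw hzw
    refine h4 ⟨p, q, r, t, ⟨k1.1, k2.1, k3.1, k4.1, k5.1, k6.1⟩, ?_⟩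
    simp [k1.2, k2.2, k3.2, k4.2, k5.2, k6.2]
  refine ⟨insert b₀ T, Set.insert_subset hb₀ (Set.sep_subset _ _),
    (Set.ncard_insert_le _ _).trans (Nat.succ_le_succ hT3), fun s hs => ?_⟩
  by_cases hsb : G.Adj s b₀
  · exact ⟨b₀, by simp, hsb⟩
  · obtain ⟨b, hb, hsb'⟩ := h.full_right s hs
    exact ⟨b, Set.mem_insert_of_mem _ ⟨hb, s, hs, hsb, hsb'⟩, hsb'⟩

theorem dom_of_not_hasDiamond [Finite V] (h4 : ¬ HasFourP1 G) (hC : ¬ HasC4 G)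
    (hd : ¬ HasDiamond G) (h : FullPair G A B S) : Dom G 4 A S ∨ Dom G 4 B S := by
  by_cases hB : G.IsClique B
  · exact Or.inr (dom_right_of_not_hasDiamond h4 hC hd h hB)
  · refine Or.inl (dom_right_of_not_hasDiamond h4 hC hd h.symm fun x hx y hy hxy => ?_)
    by_contra hadj
    refine hB fun p hp q hq hpq => ?_
    by_contra hadj'
    refine h4 ⟨x, y, p, q, ⟨hxy, h.ne hx hp, h.ne hx hq, h.ne hy hp, h.ne hy hq, hpq⟩, ?_⟩
    simp [hadj, hadj', h.not_adj hx hp, h.not_adj hx hq, h.not_adj hy hp, h.not_adj hy hq]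

theorem cliqueLE_or_dom [Finite V] (hG : ¬ HasCoClaw G ∨ ¬ HasPaw G ∨ ¬ HasK4 G)
    (h : FullPair G A B S) : CliqueLE G A ∨ Dom G 16 A S := by
  rcases hG with hG | hG | hG
  · exact Or.inl (cliqueLE_of_triangleFree (triangleFree_of_not_hasCoClaw hG h))
  · rcases S.eq_empty_or_nonempty with rfl | hS
    · exact Or.inr ⟨∅, Set.empty_subset _, by simp, by simp⟩
    · exact Or.inl (cliqueLE_of_triangleFree (triangleFree_of_not_hasPaw hG h hS))
  · exact Or.inl (cliqueLE_of_not_hasK4 hG A)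

theorem Dom.mono {K L : ℕ} (hKL : K ≤ L) (h : Dom G K A S) : Dom G L A S := by
  obtain ⟨T, hT, hTK, hS⟩ := h
  exact ⟨T, hT, hTK.trans hKL, hS⟩

/-- Cliques in `A` have at most three vertices. If `B` is not a single vertex, `A` is a clique or
has no independent triple, so `|A| ≤ (3 + 1) ^ 2 = 16`. -/
theorem dom_of_bounded_clique [Finite V]
    (h3 : ¬ HasFourP1 G ∨ ¬ HasCoDiamond G ∨ ¬ HasCoPaw G)
    (h1 : ¬ HasCoClaw G ∨ ¬ HasPaw G ∨ ¬ HasK4 G)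
    (h : FullPair G A B S) : Dom G 16 A S ∨ Dom G 16 B S := by
  rcases cliqueLE_or_dom h1 h with hcl | hd
  swap
  · exact Or.inl hd
  by_cases hB : B.ncard ≤ 1
  · exact Or.inr (dom_of_ncard_le h.symm (hB.trans (by norm_num)))
  refine Or.inl (dom_of_ncard_le h ?_)
  rcases h3 with h3 | h3 | h3
  · exact card_le_of_clique_le (fun x hx y hy z hz => exists_adj_of_not_hasFourP1 h3 h hx hy hz)
      3 hcl
  · exact (hcl A subset_rfl (isClique_of_not_hasCoDiamond h3 h hB)).trans (by norm_num)
  · exact (hcl A subset_rfl (isClique_of_not_hasCoPaw h3 h)).trans (by norm_num)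

theorem dom_of_not_hasC4 [Finite V] (h3 : ¬ HasCoDiamond G ∨ ¬ HasCoPaw G) (h4 : ¬ HasC4 G)
    (h : FullPair G A B S) : Dom G 2 A S ∨ Dom G 2 B S := by
  by_cases hB : B.ncard ≤ 1
  · exact Or.inr (dom_of_ncard_le h.symm (hB.trans (by norm_num)))
  refine Or.inl ?_
  rcases h3 with h3 | h3
  · exact dom_of_isClique_of_not_hasC4 h4 h (isClique_of_not_hasCoDiamond h3 h hB)
      (sep_adj_of_not_hasCoDiamond h4 h3 h)
  · have hA := isClique_of_not_hasCoPaw h3 h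
    exact dom_of_isClique_of_not_hasC4 h4 h hA
      (sep_adj_of_not_hasCoPaw h4 h3 h hA (isClique_of_not_hasCoPaw h3 h.symm))

end Combinatorics

/-- The combinations of excluded induced subgraphs that make a class of graphs tame. -/
def TameExclusion {V : Type} (G : SimpleGraph V) : Prop :=
  ¬ HasP4 G ∨ ¬ HasTwoK2 G ∨
  ((¬ HasFourP1 G ∨ ¬ HasCoDiamond G ∨ ¬ HasCoPaw G) ∧
    (¬ HasCoClaw G ∨ ¬ HasPaw G ∨ ¬ HasK4 G)) ∨
  ((¬ HasCoDiamond G ∨ ¬ HasCoPaw G) ∧ ¬ HasC4 G) ∨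
  (¬ HasClaw G ∧ (¬ HasCoClaw G ∨ ¬ HasPaw G)) ∨
  (¬ HasFourP1 G ∧ ¬ HasC4 G ∧ ¬ HasDiamond G)

theorem tame_of_tameExclusion {C : Set FinGraph} (h : ∀ G ∈ C, TameExclusion G.graph) :
    Tame C := by
  refine tame_of_dom 16 fun G hG A B S hp => ?_
  have up : ∀ {K : ℕ}, K ≤ 16 → Dom G.graph K A S ∨ Dom G.graph K B S →
      Dom G.graph 16 A S ∨ Dom G.graph 16 B S := fun hK h => h.imp (Dom.mono hK) (Dom.mono hK)
  rcases h G hG with h | h | ⟨h3, h1⟩ | ⟨h3, h4⟩ | ⟨hc, h | h⟩ | ⟨h4, hC, hd⟩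
  · exact up (by norm_num) (Or.inl (dom_of_not_hasP4 h hp))
  · exact up (by norm_num) (dom_of_not_hasTwoK2 h hp)
  · exact dom_of_bounded_clique h3 h1 hp
  · exact up (by norm_num) (dom_of_not_hasC4 h3 h4 hp)
  · exact up (by norm_num) (dom_of_not_hasClaw_of_not_hasCoClaw hc h hp)
  · exact up (by norm_num) (Or.inl (dom_of_not_hasClaw_of_not_hasPaw hc h hp))
  · exact up (by norm_num) (dom_of_not_hasDiamond h4 hC hd hp)

end FinGraph

namespace FinGraph

open SimpleGraph

/-! ### Patterns as induced subgraphs -/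

section Patterns

/-- The adjacency matrix of the graph on `Fin 4` with prescribed adjacencies
`01, 02, 03, 12, 13, 23`. -/
def quadAdj (a b c d e f : Bool) : Fin 4 → Fin 4 → Bool :=
  ![![false, a, b, c], ![a, false, d, e], ![b, d, false, f], ![c, e, f, false]]

/-- The graph on `Fin 4` with prescribed adjacencies `01, 02, 03, 12, 13, 23`. -/
def quadGraph (a b c d e f : Bool) : SimpleGraph (Fin 4) where
  Adj i j := quadAdj a b c d e f i j = true
  symm := ⟨fun i j => by fin_cases i <;> fin_cases j <;> simp [quadAdj]⟩
  loopless := ⟨fun i => by fin_cases i <;> simp [quadAdj]⟩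

theorem isIndContained_of_equiv {V W : Type} {G : SimpleGraph V} {H : SimpleGraph W} {k : ℕ}
    (e : Fin k ≃ V) (g : Fin k → W) (hg : Function.Injective g)
    (h : ∀ i j, i < j → (G.Adj (e i) (e j) ↔ H.Adj (g i) (g j))) : G.IsIndContained H := by
  refine ⟨⟨⟨g ∘ e.symm, hg.comp e.symm.injective⟩, fun {u v} => ?_⟩⟩
  obtain ⟨i, rfl⟩ := e.surjective u
  obtain ⟨j, rfl⟩ := e.surjective v
  simp only [Function.Embedding.coeFn_mk, Function.comp_apply, Equiv.symm_apply_apply]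
  rcases lt_trichotomy i j with hij | rfl | hij
  · exact (h i j hij).symm
  · simp
  · rw [G.adj_comm, H.adj_comm]; exact (h j i hij).symm

theorem hasQuad_iff {V : Type} {G : SimpleGraph V} {a b c d e f : Bool} :
    HasQuad G a b c d e f ↔ (quadGraph a b c d e f).IsIndContained G := by
  constructor
  · rintro ⟨x, y, z, w, ⟨h1, h2, h3, h4, h5, h6⟩, k1, k2, k3, k4, k5, k6⟩
    refine isIndContained_of_equiv (Equiv.refl _) ![x, y, z, w] (fun i j hij => ?_) ?_
    · fin_cases i <;> fin_cases j <;> simp_all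
    · intro i j hij
      fin_cases i <;> fin_cases j <;> simp_all [quadGraph, quadAdj]
  · rintro ⟨φ⟩
    have hne : ∀ i j : Fin 4, i ≠ j → φ i ≠ φ j := fun i j hij h => hij (φ.injective h)
    refine ⟨φ 0, φ 1, φ 2, φ 3, ⟨hne _ _ (by decide), hne _ _ (by decide), hne _ _ (by decide),
      hne _ _ (by decide), hne _ _ (by decide), hne _ _ (by decide)⟩, ?_⟩
    simp only [Embedding.map_adj_iff]
    simp [quadGraph, quadAdj]

theorem HasQuad.trans {V W : Type} {G : SimpleGraph V} {H : SimpleGraph W} {a b c d e f : Bool}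
    (h : HasQuad H a b c d e f) (hHG : H.IsIndContained G) : HasQuad G a b c d e f :=
  hasQuad_iff.2 ((hasQuad_iff.1 h).trans hHG)

/-- `H` is isomorphic to `quadGraph a b c d e f`. -/
def IsQuad (H : FinGraph) (a b c d e f : Bool) : Prop :=
  H.order = 4 ∧ HasQuad H.graph a b c d e f

theorem IsQuad.nonempty_iso {H : FinGraph} {a b c d e f : Bool} (h : IsQuad H a b c d e f) :
    Nonempty (quadGraph a b c d e f ≃g H.graph) := by
  obtain ⟨φ⟩ := hasQuad_iff.1 h.2
  have hcard : Nat.card (Fin 4) = Nat.card H.V := by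
    rw [Nat.card_eq_fintype_card, Fintype.card_fin]; exact h.1.symm
  exact ⟨RelIso.ofSurjective φ
    ((Nat.bijective_iff_injective_and_card _).2 ⟨φ.injective, hcard⟩).2⟩

theorem IsQuad.iso {H K : FinGraph} {a b c d e f : Bool} (h : IsQuad H a b c d e f)
    (k : IsQuad K a b c d e f) : Iso H K := by
  obtain ⟨φ⟩ := h.nonempty_iso
  obtain ⟨ψ⟩ := k.nonempty_iso
  exact ⟨φ.symm.trans ψ⟩

theorem IsQuad.isIndContained_iff {H : FinGraph} {a b c d e f : Bool}
    (h : IsQuad H a b c d e f) {V : Type} {G : SimpleGraph V} :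
    H.graph.IsIndContained G ↔ HasQuad G a b c d e f := by
  obtain ⟨φ⟩ := h.nonempty_iso
  rw [hasQuad_iff]
  exact ⟨fun k => IsIndContained.trans ⟨φ.toEmbedding⟩ k,
    fun k => IsIndContained.trans ⟨φ.symm.toEmbedding⟩ k⟩

theorem four_distinct : (0 : Fin 4) ≠ 1 ∧ (0 : Fin 4) ≠ 2 ∧ (0 : Fin 4) ≠ 3 ∧ (1 : Fin 4) ≠ 2 ∧
    (1 : Fin 4) ≠ 3 ∧ (2 : Fin 4) ≠ 3 := by decide

theorem isQuad_fourP1 : IsQuad fourP1 false false false false false false :=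
  ⟨by simp [order, fourP1], (0 : Fin 4), (1 : Fin 4), (2 : Fin 4), (3 : Fin 4), four_distinct,
    by simp [fourP1]⟩

theorem isQuad_K4 : IsQuad K4 true true true true true true :=
  ⟨by simp [order, K4], (0 : Fin 4), (1 : Fin 4), (2 : Fin 4), (3 : Fin 4), four_distinct,
    by simp [K4]⟩

theorem isQuad_C4 : IsQuad C4 true false true true false true :=
  ⟨by simp [order, C4], (0 : Fin 4), (1 : Fin 4), (2 : Fin 4), (3 : Fin 4), four_distinct,
    by simp only [C4, cycleGraph_adj]; decide⟩

theorem isQuad_diamond : IsQuad diamond true true true true true false :=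
  ⟨by simp [order, diamond], (2 : Fin 4), (3 : Fin 4), (0 : Fin 4), (1 : Fin 4),
    (by decide : (2 : Fin 4) ≠ 3 ∧ (2 : Fin 4) ≠ 0 ∧ (2 : Fin 4) ≠ 1 ∧ (3 : Fin 4) ≠ 0 ∧
      (3 : Fin 4) ≠ 1 ∧ (0 : Fin 4) ≠ 1),
    by simp [diamond]⟩

theorem isQuad_claw : IsQuad claw true true true false false false :=
  ⟨by simp [order, claw], (Sum.inl 0 : Fin 1 ⊕ Fin 3), (Sum.inr 0 : Fin 1 ⊕ Fin 3),
    (Sum.inr 1 : Fin 1 ⊕ Fin 3), (Sum.inr 2 : Fin 1 ⊕ Fin 3), by simp [claw],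
    by simp [claw]⟩

/-- `G` has a triangle. -/
def HasTriangle {V : Type} (G : SimpleGraph V) : Prop :=
  ∃ x y z, G.Adj x y ∧ G.Adj x z ∧ G.Adj y z

/-- `G` has three pairwise non-adjacent vertices. -/
def HasIndepTriple {V : Type} (G : SimpleGraph V) : Prop :=
  ∃ x y z, (x ≠ y ∧ x ≠ z ∧ y ≠ z) ∧ ¬ G.Adj x y ∧ ¬ G.Adj x z ∧ ¬ G.Adj y z

theorem K3_isIndContained_iff {V : Type} {G : SimpleGraph V} :
    K3.graph.IsIndContained G ↔ HasTriangle G := by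
  constructor
  · rintro ⟨φ⟩
    change (⊤ : SimpleGraph (Fin 3)) ↪g G at φ
    refine ⟨φ 0, φ 1, φ 2, ?_⟩
    simp only [Embedding.map_adj_iff]
    simp
  · rintro ⟨x, y, z, hxy, hxz, hyz⟩
    refine isIndContained_of_equiv (Equiv.refl (Fin 3)) ![x, y, z] (fun i j hij => ?_) ?_
    · have := hxy.ne
      have := hxz.ne
      have := hyz.ne
      fin_cases i <;> fin_cases j <;> simp_all
    · intro i j hij
      refine iff_of_true hij.ne ?_
      fin_cases i <;> fin_cases j <;> simp_all

theorem threeP1_isIndContained_iff {V : Type} {G : SimpleGraph V} :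
    threeP1.graph.IsIndContained G ↔ HasIndepTriple G := by
  constructor
  · rintro ⟨φ⟩
    change (⊥ : SimpleGraph (Fin 3)) ↪g G at φ
    have hne : ∀ i j : Fin 3, i ≠ j → φ i ≠ φ j := fun i j hij h => hij (φ.injective h)
    refine ⟨φ 0, φ 1, φ 2, ⟨hne _ _ (by decide), hne _ _ (by decide), hne _ _ (by decide)⟩, ?_⟩
    simp only [Embedding.map_adj_iff]
    simp
  · rintro ⟨x, y, z, ⟨h1, h2, h3⟩, hxy, hxz, hyz⟩
    refine isIndContained_of_equiv (Equiv.refl (Fin 3)) ![x, y, z] (fun i j hij => ?_) ?_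
    · fin_cases i <;> fin_cases j <;> simp_all
    · intro i j hij
      fin_cases i <;> fin_cases j <;> simp_all [threeP1]

theorem HasTriangle.trans {V W : Type} {G : SimpleGraph V} {H : SimpleGraph W}
    (h : HasTriangle H) (hHG : H.IsIndContained G) : HasTriangle G :=
  K3_isIndContained_iff.1 ((K3_isIndContained_iff.2 h).trans hHG)

theorem HasIndepTriple.trans {V W : Type} {G : SimpleGraph V} {H : SimpleGraph W}
    (h : HasIndepTriple H) (hHG : H.IsIndContained G) : HasIndepTriple G :=
  threeP1_isIndContained_iff.1 ((threeP1_isIndContained_iff.2 h).trans hHG)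

end Patterns

/-! ### Graphs with at most four vertices -/

section Classification

/-- A finite check over the 64 labelled graphs: some reordering of the vertices gives one of the
eleven normal forms. -/
theorem exists_normal_quadAdj : ∀ a b c d e f : Bool, ∃ x y z w : Fin 4,
    (x ≠ y ∧ x ≠ z ∧ x ≠ w ∧ y ≠ z ∧ y ≠ w ∧ z ≠ w) ∧
    (quadAdj a b c d e f x y, quadAdj a b c d e f x z, quadAdj a b c d e f x w,
      quadAdj a b c d e f y z, quadAdj a b c d e f y w, quadAdj a b c d e f z w) ∈
    [(true, false, false, true, false, true), (true, false, false, false, false, true),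
     (false, false, false, false, false, false), (true, false, false, false, false, false),
     (true, false, false, true, false, false), (true, true, true, false, false, false),
     (true, true, false, true, false, false), (true, false, true, true, false, true),
     (true, true, true, true, false, false), (true, true, true, true, true, false),
     (true, true, true, true, true, true)] := by
  decide +kernel

theorem hasQuad_cases {V : Type} {G : SimpleGraph V} {a b c d e f : Bool}
    (h : HasQuad G a b c d e f) :
    HasP4 G ∨ HasTwoK2 G ∨ HasFourP1 G ∨ HasCoDiamond G ∨ HasCoPaw G ∨ HasClaw G ∨
      HasCoClaw G ∨ HasC4 G ∨ HasPaw G ∨ HasDiamond G ∨ HasK4 G := by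
  obtain ⟨x, y, z, w, hne, hmem⟩ := exists_normal_quadAdj a b c d e f
  have key : HasQuad G (quadAdj a b c d e f x y) (quadAdj a b c d e f x z)
      (quadAdj a b c d e f x w) (quadAdj a b c d e f y z) (quadAdj a b c d e f y w)
      (quadAdj a b c d e f z w) :=
    HasQuad.trans (H := quadGraph a b c d e f) ⟨x, y, z, w, hne, by simp [quadGraph]⟩
      (hasQuad_iff.1 h)
  generalize quadAdj a b c d e f x y = p1, quadAdj a b c d e f x z = p2,
    quadAdj a b c d e f x w = p3, quadAdj a b c d e f y z = p4, quadAdj a b c d e f y w = p5,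
    quadAdj a b c d e f z w = p6 at key hmem
  simp only [List.mem_cons, Prod.mk.injEq, List.not_mem_nil, or_false] at hmem
  rcases hmem with h | h | h | h | h | h | h | h | h | h | h <;>
    obtain ⟨rfl, rfl, rfl, rfl, rfl, rfl⟩ := h <;> simp only [key, true_or, or_true]

theorem exists_quad_of_order_eq_four {H : FinGraph} (h : H.order = 4) :
    ∃ a b c d e f, HasQuad H.graph a b c d e f := by
  classical
  have e := Finite.equivFinOfCardEq h
  refine ⟨_, _, _, _, _, _, e.symm 0, e.symm 1, e.symm 2, e.symm 3, by simp,
    (decide_eq_true_iff).symm, (decide_eq_true_iff).symm, (decide_eq_true_iff).symm,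
    (decide_eq_true_iff).symm, (decide_eq_true_iff).symm, (decide_eq_true_iff).symm⟩

abbrev P4 : SimpleGraph (Fin 4) := quadGraph true false false true false true

theorem exists_triple_P4 : ∀ a b c : Bool, ¬ (a = true ∧ b = true ∧ c = true) →
    ¬ (a = false ∧ b = false ∧ c = false) → ∃ i j k : Fin 4, (i ≠ j ∧ i ≠ k ∧ j ≠ k) ∧
      quadAdj true false false true false true i j = a ∧
      quadAdj true false false true false true i k = b ∧
      quadAdj true false false true false true j k = c := by
  decide +kernel

/-- With at most three vertices, every graph other than `3P₁` and `K₃` is induced in `P₄`. The two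
exceptions are induced in the co-diamond and the paw, so forbidding them forbids these as well. -/
theorem small_cases {H : FinGraph} (h : H.order ≤ 3) :
    H.graph.IsIndContained P4 ∨
    (HasIndepTriple H.graph ∧
      H.graph.IsIndContained (quadGraph true false false false false false)) ∨
    (HasTriangle H.graph ∧
      H.graph.IsIndContained (quadGraph true true true true false false)) := by
  classical
  have hpos : 0 < H.order := Nat.card_pos
  have h123 : H.order = 1 ∨ H.order = 2 ∨ H.order = 3 := by omega
  rcases h123 with h | h | h
  · have e := (Finite.equivFinOfCardEq h).symm
    refine Or.inl (isIndContained_of_equiv e ![0] (fun i j _ => Subsingleton.elim i j) ?_)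
    intro i j hij
    omega
  · have e := (Finite.equivFinOfCardEq h).symm
    by_cases ha : H.graph.Adj (e 0) (e 1)
    · refine Or.inl (isIndContained_of_equiv e ![0, 1] (by decide) ?_)
      intro i j hij
      fin_cases i <;> fin_cases j <;> simp_all [quadGraph, quadAdj]
    · refine Or.inl (isIndContained_of_equiv e ![0, 2] (by decide) ?_)
      intro i j hij
      fin_cases i <;> fin_cases j <;> simp_all [quadGraph, quadAdj]
  · have e := (Finite.equivFinOfCardEq h).symm
    have key : ∀ {a b c d e' f : Bool} (x y z : Fin 4), (x ≠ y ∧ x ≠ z ∧ y ≠ z) →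
        quadAdj a b c d e' f x y = decide (H.graph.Adj (e 0) (e 1)) →
        quadAdj a b c d e' f x z = decide (H.graph.Adj (e 0) (e 2)) →
        quadAdj a b c d e' f y z = decide (H.graph.Adj (e 1) (e 2)) →
        H.graph.IsIndContained (quadGraph a b c d e' f) := by
      intro a b c d e' f x y z hne h1 h2 h3
      refine isIndContained_of_equiv e ![x, y, z] (fun i j hij => ?_) ?_
      · fin_cases i <;> fin_cases j <;> simp_all
      · intro i j hij
        fin_cases i <;> fin_cases j <;> simp_all [quadGraph]
    have hne : ∀ i j : Fin 3, i ≠ j → e i ≠ e j := fun i j hij h => hij (e.injective h)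
    by_cases ht : H.graph.Adj (e 0) (e 1) ∧ H.graph.Adj (e 0) (e 2) ∧ H.graph.Adj (e 1) (e 2)
    · refine Or.inr (Or.inr ⟨⟨e 0, e 1, e 2, ht⟩, key 0 1 2 (by decide) ?_ ?_ ?_⟩) <;>
        simp [quadAdj, ht]
    by_cases hi : ¬ H.graph.Adj (e 0) (e 1) ∧ ¬ H.graph.Adj (e 0) (e 2) ∧
        ¬ H.graph.Adj (e 1) (e 2)
    · refine Or.inr (Or.inl ⟨⟨e 0, e 1, e 2, ⟨hne _ _ (by decide), hne _ _ (by decide),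
        hne _ _ (by decide)⟩, hi⟩, key 1 2 3 (by decide) ?_ ?_ ?_⟩) <;> simp [quadAdj, hi]
    obtain ⟨i, j, k, hd, h1, h2, h3⟩ := exists_triple_P4 (decide (H.graph.Adj (e 0) (e 1)))
      (decide (H.graph.Adj (e 0) (e 2))) (decide (H.graph.Adj (e 1) (e 2)))
      (by simpa using ht) (by simpa using hi)
    exact Or.inl (key i j k hd h1 h2 h3)

end Classification
end FinGraph

/-! ### Tameness when (i), (ii) and (iii) fail -/

namespace FinGraph

open SimpleGraph

/-- An `F'`-free graph that is not `F`-free has an induced subgraph in `F`, which inherits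
`F'`-freeness. -/
theorem exists_mem_freeClass {F F' : Set FinGraph} (h : ¬ FamilyLE F' F) :
    ∃ H ∈ F, H ∈ freeClass F' := by
  obtain ⟨G, hG', hG⟩ := Set.not_subset.1 h
  have : ∃ H ∈ F, H.graph.IsIndContained G.graph := by
    by_contra! hno
    exact hG hno
  obtain ⟨H, hH, hHG⟩ := this
  exact ⟨H, hH, fun K hK hKH => hG' K hK (hKH.trans hHG)⟩

theorem not_hasQuad_of_isQuad {F : Set FinGraph} {G H : FinGraph} (hG : G ∈ freeClass F)
    (hH : H ∈ F) {a b c d e f : Bool} (h : IsQuad H a b c d e f) :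
    ¬ HasQuad G.graph a b c d e f := fun hq => hG H hH (h.isIndContained_iff.2 hq)

theorem not_hasQuad_of_isIndContained {F : Set FinGraph} {G H : FinGraph} (hG : G ∈ freeClass F)
    (hH : H ∈ F) {a b c d e f : Bool} (h : H.graph.IsIndContained (quadGraph a b c d e f)) :
    ¬ HasQuad G.graph a b c d e f := fun hq => hG H hH (h.trans (hasQuad_iff.1 hq))

/-- A member `H` of `F` of order at most four excludes one of the listed four-vertex graphs from
the `F`-free graph `G`; most alternatives also record a property of `H`. -/
theorem exclusion_cases {F : Set FinGraph} {G H : FinGraph} (hG : G ∈ freeClass F)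
    (hH : H ∈ F) (h4 : H.order ≤ 4) :
    ¬ HasP4 G.graph ∨ ¬ HasTwoK2 G.graph ∨
    (HasIndepTriple H.graph ∧ ¬ HasCoDiamond G.graph) ∨
    (HasTriangle H.graph ∧ ¬ HasPaw G.graph) ∨
    (IsQuad H false false false false false false ∧ ¬ HasFourP1 G.graph) ∨
    (HasIndepTriple H.graph ∧ ¬ HasCoPaw G.graph) ∨
    (IsQuad H true true true false false false ∧ HasIndepTriple H.graph ∧ ¬ HasClaw G.graph) ∨
    (HasTriangle H.graph ∧ ¬ HasCoClaw G.graph) ∨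
    (IsQuad H true false true true false true ∧ ¬ HasC4 G.graph) ∨
    (IsQuad H true true true true true false ∧ HasTriangle H.graph ∧ ¬ HasDiamond G.graph) ∨
    (IsQuad H true true true true true true ∧ HasTriangle H.graph ∧ ¬ HasK4 G.graph) := by
  rcases Nat.lt_or_ge 3 H.order with h | h
  swap
  · rcases small_cases h with h | ⟨h, h'⟩ | ⟨h, h'⟩
    · exact Or.inl (not_hasQuad_of_isIndContained hG hH h)
    · have := not_hasQuad_of_isIndContained hG hH h'
      grind
    · have := not_hasQuad_of_isIndContained hG hH h'
      grind
  have h4 : H.order = 4 := by omega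
  obtain ⟨a, b, c, d, e, f, hq⟩ := exists_quad_of_order_eq_four h4
  have key : ∀ {a b c d e f : Bool}, HasQuad H.graph a b c d e f →
      IsQuad H a b c d e f ∧ ¬ HasQuad G.graph a b c d e f := fun h =>
    ⟨⟨h4, h⟩, not_hasQuad_of_isQuad hG hH ⟨h4, h⟩⟩
  have indep : ∀ {a b c : Bool}, HasQuad H.graph a b c false false false →
      HasIndepTriple H.graph := by
    rintro a b c ⟨x, y, z, w, hne, h⟩
    simp only [Bool.false_eq_true, iff_false] at h
    exact ⟨y, z, w, ⟨hne.2.2.2.1, hne.2.2.2.2.1, hne.2.2.2.2.2⟩, h.2.2.2.1, h.2.2.2.2.1,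
      h.2.2.2.2.2⟩
  have tri : ∀ {c e f : Bool}, HasQuad H.graph true true c true e f → HasTriangle H.graph := by
    rintro c e f ⟨x, y, z, w, -, h⟩
    simp only [iff_true] at h
    exact ⟨x, y, z, h.1, h.2.1, h.2.2.2.1⟩
  rcases hasQuad_cases hq with h | h | h | h | h | h | h | h | h | h | h
  · exact Or.inl (key h).2
  · exact Or.inr (Or.inl (key h).2)
  · have := key h
    grind
  · have := (key h).2
    have := indep h
    grind
  · have h' := (key h).2
    have hi : HasIndepTriple H.graph := by
      obtain ⟨x, y, z, w, hne, h⟩ := h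
      simp only [Bool.false_eq_true, iff_false] at h
      exact ⟨x, z, w, ⟨hne.2.1, hne.2.2.1, hne.2.2.2.2.2⟩, h.2.1, h.2.2.1, h.2.2.2.2.2⟩
    grind
  · have := key h
    have := indep h
    grind
  · have := (key h).2
    have := tri h
    grind
  · have := key h
    grind
  · have := (key h).2
    have := tri h
    grind
  · have := key h
    have := tri h
    grind
  · have := key h
    have := tri h
    grind

/-- If `F` had only `4P₁`, `C₄` and claws as members, it would be one of the two exceptional
families, according to whether it contains a claw. -/
theorem not_familyEq_cases {F : Set FinGraph} (h₁ : ¬ FamilyEq F {fourP1, C4})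
    (h₂ : ¬ FamilyEq F {fourP1, C4, claw}) {H K : FinGraph} (hH : H ∈ F)
    (hH4 : IsQuad H false false false false false false) (hK : K ∈ F)
    (hKC : IsQuad K true false true true false true) :
    ∃ X ∈ F, ¬ IsQuad X false false false false false false ∧
      ¬ IsQuad X true false true true false true ∧ ¬ IsQuad X true true true false false false := by
  by_contra! hall
  by_cases hclaw : ∃ X ∈ F, IsQuad X true true true false false false
  · obtain ⟨X, hX, hXc⟩ := hclaw
    refine h₂ ⟨fun Y hY => ?_, ?_⟩
    · by_cases hY1 : IsQuad Y false false false false false false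
      · exact ⟨fourP1, by simp, hY1.iso isQuad_fourP1⟩
      by_cases hY2 : IsQuad Y true false true true false true
      · exact ⟨C4, by simp, hY2.iso isQuad_C4⟩
      · exact ⟨claw, by simp, (hall Y hY hY1 hY2).iso isQuad_claw⟩
    · rintro _ (rfl | rfl | rfl)
      · exact ⟨H, hH, hH4.iso isQuad_fourP1⟩
      · exact ⟨K, hK, hKC.iso isQuad_C4⟩
      · exact ⟨X, hX, hXc.iso isQuad_claw⟩
  · refine h₁ ⟨fun Y hY => ?_, ?_⟩
    · by_cases hY1 : IsQuad Y false false false false false false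
      · exact ⟨fourP1, by simp, hY1.iso isQuad_fourP1⟩
      by_cases hY2 : IsQuad Y true false true true false true
      · exact ⟨C4, by simp, hY2.iso isQuad_C4⟩
      · exact absurd ⟨Y, hY, hall Y hY hY1 hY2⟩ hclaw
    · rintro _ (rfl | rfl)
      · exact ⟨H, hH, hH4.iso isQuad_fourP1⟩
      · exact ⟨K, hK, hKC.iso isQuad_C4⟩

theorem tame_freeClass {F : Set FinGraph} (hF : ∀ H ∈ F, H.order ≤ 4)
    (h₁ : ¬ FamilyEq F {fourP1, C4}) (h₂ : ¬ FamilyEq F {fourP1, C4, claw})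
    (hi : ¬ FamilyLE {threeP1, diamond} F) (hii : ¬ FamilyLE {claw, K4, C4, diamond} F)
    (hiii : ¬ FamilyLE {K3, C4} F) : Tame (freeClass F) := by
  refine tame_of_tameExclusion fun G hG => ?_
  obtain ⟨H₁, hH₁, f₁⟩ := exists_mem_freeClass hi
  obtain ⟨H₂, hH₂, f₂⟩ := exists_mem_freeClass hii
  obtain ⟨H₃, hH₃, f₃⟩ := exists_mem_freeClass hiii
  have n₁ : ¬ HasIndepTriple H₁.graph := fun h =>
    f₁ threeP1 (by simp) (threeP1_isIndContained_iff.2 h)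
  have d₁ : ¬ IsQuad H₁ true true true true true false := fun h =>
    f₁ diamond (by simp) (isQuad_diamond.isIndContained_iff.2 h.2)
  have p₁ : ¬ IsQuad H₁ false false false false false false := by
    rintro ⟨-, x, y, z, w, hne, h⟩
    simp only [Bool.false_eq_true, iff_false] at h
    exact n₁ ⟨x, y, z, ⟨hne.1, hne.2.1, hne.2.2.2.1⟩, h.1, h.2.1, h.2.2.2.1⟩
  have c₂ : ¬ IsQuad H₂ true true true false false false := fun h =>
    f₂ claw (by simp) (isQuad_claw.isIndContained_iff.2 h.2)
  have k₂ : ¬ IsQuad H₂ true true true true true true := fun h =>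
    f₂ K4 (by simp) (isQuad_K4.isIndContained_iff.2 h.2)
  have q₂ : ¬ IsQuad H₂ true false true true false true := fun h =>
    f₂ C4 (by simp) (isQuad_C4.isIndContained_iff.2 h.2)
  have d₂ : ¬ IsQuad H₂ true true true true true false := fun h =>
    f₂ diamond (by simp) (isQuad_diamond.isIndContained_iff.2 h.2)
  have t₃ : ¬ HasTriangle H₃.graph := fun h =>
    f₃ K3 (by simp) (K3_isIndContained_iff.2 h)
  have q₃ : ¬ IsQuad H₃ true false true true false true := fun h =>
    f₃ C4 (by simp) (isQuad_C4.isIndContained_iff.2 h.2)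
  -- The next three facts list what each witness can exclude from `G`. `C₄` and `4P₁` keep the
  -- identity of the witness, because the exceptional case needs both as members of `F`.
  have e₁ : ¬ HasP4 G.graph ∨ ¬ HasTwoK2 G.graph ∨ ¬ HasPaw G.graph ∨ ¬ HasCoClaw G.graph ∨
      ¬ HasK4 G.graph ∨ (IsQuad H₁ true false true true false true ∧ ¬ HasC4 G.graph) := by
    have := exclusion_cases hG hH₁ (hF H₁ hH₁)
    grind
  have e₂ : ¬ HasP4 G.graph ∨ ¬ HasTwoK2 G.graph ∨ ¬ HasCoDiamond G.graph ∨ ¬ HasPaw G.graph ∨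
      ¬ HasCoPaw G.graph ∨ ¬ HasCoClaw G.graph ∨
      (IsQuad H₂ false false false false false false ∧ ¬ HasFourP1 G.graph) := by
    have := exclusion_cases hG hH₂ (hF H₂ hH₂)
    grind
  have e₃ : ¬ HasP4 G.graph ∨ ¬ HasTwoK2 G.graph ∨ ¬ HasCoDiamond G.graph ∨
      ¬ HasCoPaw G.graph ∨ ¬ HasClaw G.graph ∨
      (IsQuad H₃ false false false false false false ∧ ¬ HasFourP1 G.graph) := by
    have := exclusion_cases hG hH₃ (hF H₃ hH₃)
    grind
  have e₄ : ∀ H ∈ F, ∀ K ∈ F, IsQuad H false false false false false false →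
      IsQuad K true false true true false true →
      ¬ HasP4 G.graph ∨ ¬ HasTwoK2 G.graph ∨ ¬ HasCoDiamond G.graph ∨ ¬ HasPaw G.graph ∨
      ¬ HasCoPaw G.graph ∨ ¬ HasCoClaw G.graph ∨ ¬ HasDiamond G.graph ∨ ¬ HasK4 G.graph := by
    intro H hH K hK hH4 hKC
    obtain ⟨X, hX, hX1, hX2, hX3⟩ := not_familyEq_cases h₁ h₂ hH hH4 hK hKC
    have := exclusion_cases hG hX (hF X hX)
    grind
  have e₄₂ := e₄ H₂ hH₂ H₁ hH₁
  have e₄₃ := e₄ H₃ hH₃ H₁ hH₁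
  -- Beyond `P₄` and `2K₂`: if `H₁` excludes paw, co-claw or `K₄`, it pairs with a `4P₁`, co-diamond
  -- or co-paw from `H₃` or `H₂`, or the claw case applies. If `H₁` is `C₄`, a co-diamond or co-paw
  -- suffices, or claw with paw or co-claw. Otherwise `4P₁` and `C₄` are both in `F`, and the extra
  -- member from `e₄` decides.
  unfold TameExclusion
  grind

end FinGraph

/-! ### Exponentially many minimal separators -/

namespace FinGraph

open SimpleGraph Relation

theorem not_tame_of_two_pow_le {C : Set FinGraph} (c d : ℕ)
    (h : ∀ n : ℕ, ∃ G ∈ C, G.order = c * n + d ∧ 2 ^ n ≤ G.numMinSeparators) : ¬ Tame C := by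
  rintro ⟨p, hp⟩
  have hlog : (0 : ℝ) < Real.log 2 := Real.log_pos (by norm_num)
  -- `q` is chosen so that `q (n log 2) = p (c n + d)`, while `exp (n log 2) = 2 ^ n`; so `p (c n +
  -- d) / 2 ^ n` tends to zero.
  let q : Polynomial ℝ := p.comp
    (Polynomial.C (c / Real.log 2) * Polynomial.X + Polynomial.C (d : ℝ))
  have hlim := (Polynomial.tendsto_div_exp_atTop q).comp
    (tendsto_natCast_atTop_atTop.atTop_mul_const hlog)
  obtain ⟨n, hn⟩ := (hlim.eventually_lt_const (show (0 : ℝ) < 1 by norm_num)).exists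
  obtain ⟨G, hG, hord, hnum⟩ := h n
  have h1 := hp G hG
  have hexp : Real.exp ((n : ℝ) * Real.log 2) = 2 ^ n := by
    rw [mul_comm, Real.exp_mul, Real.exp_log (by norm_num), Real.rpow_natCast]
  have hq : q.eval ((n : ℝ) * Real.log 2) = p.eval (G.order : ℝ) := by
    simp only [q, Polynomial.eval_comp, Polynomial.eval_add, Polynomial.eval_mul,
      Polynomial.eval_C, Polynomial.eval_X, hord]
    congr 1
    push_cast
    field_simp
  simp only [Function.comp_apply] at hn
  rw [hexp, hq, div_lt_one (by positivity)] at hn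
  have h2 : (2 : ℝ) ^ n ≤ G.numMinSeparators := by exact_mod_cast hnum
  linarith

/-! ### Ladders -/

section Ladder

variable {W : Type}

/-- Two copies of `R`, whose corresponding vertices are joined by an edge if they lie in `I`. -/
def ladder (R : SimpleGraph W) (I : Set W) : SimpleGraph (Bool × W) where
  Adj p q := (p.1 = q.1 ∧ R.Adj p.2 q.2) ∨ (p.1 ≠ q.1 ∧ p.2 = q.2 ∧ p.2 ∈ I)
  symm := ⟨by
    rintro p q (⟨h, h'⟩ | ⟨h, h', hI⟩)
    · exact Or.inl ⟨h.symm, h'.symm⟩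
    · exact Or.inr ⟨h.symm, h'.symm, h' ▸ hI⟩⟩
  loopless := ⟨by
    rintro p (⟨-, h⟩ | ⟨h, -⟩)
    · exact R.irrefl h
    · exact h rfl⟩

/-- The vertices that remain in the copy `s` if each vertex `w` of `I` is removed from the copy
`T w`. -/
def active (I : Set W) (T : W → Bool) (s : Bool) : Set W := {w | w ∈ I → T w ≠ s}

/-- A removed vertex sees the opposite copy through its rung, whose other end survives. So only
connectivity of what is left of each copy, and a surviving neighbour within its own copy, have to be
assumed. -/
theorem fullPair_ladder {R : SimpleGraph W} {I : Set W} {T : W → Bool}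
    (hconn : ∀ s, ∃ c ∈ active I T s, ∀ w ∈ active I T s, w ∈ comp R (active I T s)ᶜ c)
    (hfull : ∀ w ∈ I, ∃ w' ∈ active I T (T w), R.Adj w w') :
    FullPair (ladder R I) {p | p.1 = true ∧ p.2 ∈ active I T true}
      {p | p.1 = false ∧ p.2 ∈ active I T false} {p | p.2 ∈ I ∧ p.1 = T p.2} := by
  have conn : ∀ s, ∀ a ∈ {p : Bool × W | p.1 = s ∧ p.2 ∈ active I T s},
      ∀ a' ∈ {p : Bool × W | p.1 = s ∧ p.2 ∈ active I T s},
      a' ∈ comp (ladder R I) {p : Bool × W | p.1 = s ∧ p.2 ∈ active I T s}ᶜ a := by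
    intro s
    obtain ⟨c, hc, h⟩ := hconn s
    have key : ∀ a ∈ {p : Bool × W | p.1 = s ∧ p.2 ∈ active I T s},
        a ∈ comp (ladder R I) {p : Bool × W | p.1 = s ∧ p.2 ∈ active I T s}ᶜ (s, c) := by
      rintro ⟨_, w⟩ ⟨rfl, hw⟩
      refine comp_subset (P := {w | ((_, w) : Bool × W) ∈ comp (ladder R I) _ (_, c)})
        ReflTransGen.refl (fun x hx y hxy hy => ?_) (h w hw)
      exact ReflTransGen.tail hx ⟨Or.inl ⟨rfl, hxy⟩, fun hcon => hcon ⟨rfl, not_not.1 hy⟩⟩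
    intro a ha a' ha'
    exact comp_trans (comp_symm (fun hcon => hcon ⟨rfl, hc⟩) (key a ha)) (key a' ha')
  have nbr : ∀ s, ∀ a ∈ {p : Bool × W | p.1 = s ∧ p.2 ∈ active I T s}, ∀ v,
      (ladder R I).Adj a v → v ∈ {p : Bool × W | p.1 = s ∧ p.2 ∈ active I T s} ∨
        v ∈ {p : Bool × W | p.2 ∈ I ∧ p.1 = T p.2} := by
    rintro s ⟨s₀, w⟩ ⟨h₀, hw⟩ ⟨s', w'⟩ (⟨h', hadj⟩ | ⟨hne, h', hI⟩)
    · obtain rfl : s₀ = s := h₀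
      obtain rfl : s₀ = s' := h'
      by_cases hw' : w' ∈ active I T s₀
      · exact Or.inl ⟨rfl, hw'⟩
      · simp only [active, Set.mem_ofPred_eq, Classical.not_imp, not_not] at hw'
        exact Or.inr ⟨hw'.1, hw'.2.symm⟩
    · obtain rfl : s₀ = s := h₀
      obtain rfl : w = w' := h'
      refine Or.inr ⟨hI, ?_⟩
      have h1 : T w ≠ s₀ := hw hI
      have h2 : s₀ ≠ s' := hne
      change s' = T w
      revert h1 h2
      cases s₀ <;> cases s' <;> cases T w <;> simp
  have full : ∀ s, ∀ v ∈ {p : Bool × W | p.2 ∈ I ∧ p.1 = T p.2},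
      ∃ a ∈ {p : Bool × W | p.1 = s ∧ p.2 ∈ active I T s}, (ladder R I).Adj v a := by
    rintro s ⟨s', w⟩ ⟨hI, h'⟩
    obtain rfl : s' = T w := h'
    by_cases hs : T w = s
    · obtain ⟨w', hw', hadj⟩ := hfull w hI
      exact ⟨(s, w'), ⟨rfl, hs ▸ hw'⟩, Or.inl ⟨hs, hadj⟩⟩
    · exact ⟨(s, w), ⟨rfl, fun _ => hs⟩, Or.inr ⟨hs, rfl, hI⟩⟩
  have disj : ∀ s, ∀ v ∈ {p : Bool × W | p.1 = s ∧ p.2 ∈ active I T s},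
      v ∉ {p : Bool × W | p.2 ∈ I ∧ p.1 = T p.2} := by
    rintro s ⟨_, w⟩ ⟨rfl, hw⟩ ⟨hI, h⟩
    exact hw hI h.symm
  have ne : ∀ s, {p : Bool × W | p.1 = s ∧ p.2 ∈ active I T s}.Nonempty := fun s => by
    obtain ⟨c, hc, -⟩ := hconn s
    exact ⟨(s, c), rfl, hc⟩
  exact
    { nonempty_left := ne true
      nonempty_right := ne false
      conn_left := conn true
      conn_right := conn false
      disj := by rintro v ⟨h, -⟩ ⟨h', -⟩; rw [h] at h'; exact absurd h' (by decide)
      disj_left := disj true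
      disj_right := disj false
      nbr_left := nbr true
      nbr_right := nbr false
      full_left := full true
      full_right := full false }

/-- The ladder as a finite graph. -/
def ladderGraph [Finite W] [Nonempty W] (R : SimpleGraph W) (I : Set W) : FinGraph :=
  ⟨Bool × W, ladder R I⟩

theorem order_ladderGraph [Finite W] [Nonempty W] (R : SimpleGraph W) (I : Set W) :
    (ladderGraph R I).order = 2 * Nat.card W := by
  change Nat.card (Bool × W) = _
  rw [Nat.card_prod, Nat.card_eq_fintype_card (α := Bool), Fintype.card_bool]

/-- The rungs `e i` carry free choices `t i`, which can be read off from the separator; `E` extends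
them to the remaining vertices. -/
theorem two_pow_le_numMinSeparators [Finite W] [Nonempty W] {R : SimpleGraph W} {I : Set W}
    {n : ℕ} (E : (Fin n → Bool) → W → Bool) (e : Fin n → W) (he : ∀ i, e i ∈ I)
    (hE : ∀ t i, E t (e i) = t i)
    (hconn : ∀ t s, ∃ c ∈ active I (E t) s, ∀ w ∈ active I (E t) s,
      w ∈ comp R (active I (E t) s)ᶜ c)
    (hfull : ∀ t, ∀ w ∈ I, ∃ w' ∈ active I (E t) (E t w), R.Adj w w') :
    2 ^ n ≤ (ladderGraph R I).numMinSeparators := by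
  let φ : (Fin n → Bool) → Set (Bool × W) := fun t => {p | p.2 ∈ I ∧ p.1 = E t p.2}
  have hinj : Function.Injective φ := by
    intro t t' h
    funext i
    have : ((t i, e i) : Bool × W) ∈ φ t := ⟨he i, (hE t i).symm⟩
    rw [h] at this
    exact this.2.trans (hE t' i)
  have hsub : Set.range φ ⊆ (ladderGraph R I).minSeparators := by
    rintro _ ⟨t, rfl⟩
    exact FullPair.mem_minSeparators (G := ladderGraph R I) (fullPair_ladder (hconn t) (hfull t))
  have hcard : (Set.range φ).ncard = 2 ^ n := by
    rw [← Set.image_univ, Set.ncard_image_of_injective _ hinj, Set.ncard_univ,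
      Nat.card_eq_fintype_card]
    simp
  rw [← hcard]
  exact Set.ncard_le_ncard hsub (Set.toFinite _)

end Ladder

/-! ### The three non-tame classes -/

section Examples

/-- Two cliques joined by a perfect matching: two cliques cover all vertices, so there is no `3P₁`,
and no triangle uses a matching edge, so there is no diamond. -/
theorem not_tame_threeP1_diamond : ¬ Tame (freeClass {threeP1, diamond}) := by
  refine not_tame_of_two_pow_le 2 4 fun n =>
    ⟨ladderGraph (⊤ : SimpleGraph (Bool ⊕ Fin n)) Set.univ, ?_, ?_, ?_⟩
  · rintro H (rfl | rfl)
    · rw [threeP1_isIndContained_iff]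
      change ¬ HasIndepTriple (ladder _ _)
      rintro ⟨⟨s, x⟩, ⟨t, y⟩, ⟨u, z⟩, hne, h⟩
      simp only [ladder, top_adj, Set.mem_univ] at h
      cases s <;> cases t <;> cases u <;> simp at h <;> grind
    · rw [isQuad_diamond.isIndContained_iff]
      change ¬ HasDiamond (ladder _ _)
      rintro ⟨⟨s, x⟩, ⟨t, y⟩, ⟨u, z⟩, ⟨v, w⟩, hne, h⟩
      simp only [ladder, top_adj, Set.mem_univ] at h
      cases s <;> cases t <;> cases u <;> cases v <;> simp at h <;> grind
  · rw [order_ladderGraph, Nat.card_eq_fintype_card]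
    simp
    ring
  -- The two rungs `Sum.inl b` have fixed choices: `Sum.inl (!s)` always survives in copy `s`, so
  -- neither side becomes empty.
  · refine two_pow_le_numMinSeparators (fun t => Sum.elim id t) Sum.inr (fun _ => trivial)
      (fun _ _ => rfl) (fun t s => ⟨Sum.inl (!s), by simp [active], fun w hw => ?_⟩)
      (fun t w _ => ⟨Sum.inl (! (Sum.elim id t w)), by simp [active], ?_⟩)
    · by_cases hw' : w = Sum.inl (!s)
      · subst hw'; exact ReflTransGen.refl
      · exact ReflTransGen.single ⟨Ne.symm hw', fun h => h hw⟩
    · intro h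
      have h : w = Sum.inl (! (Sum.elim id t w)) := h
      rcases w with b | i
      · cases b <;> simp at h
      · simp at h

/-- The star with centre `none`. -/
def star (n : ℕ) : SimpleGraph (Option (Fin n)) where
  Adj x y := (x = none ∧ y ≠ none) ∨ (x ≠ none ∧ y = none)
  symm := ⟨fun _ _ h => h.elim (fun h => Or.inr ⟨h.2, h.1⟩) (fun h => Or.inl ⟨h.2, h.1⟩)⟩
  loopless := ⟨fun _ h => h.elim (fun h => h.2 h.1) (fun h => h.1 h.2)⟩

/-- Two stars with corresponding leaves joined form paths of length three between the centres, so
every cycle has length six. The centres carry no rung and always survive. -/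
theorem not_tame_K3_C4 : ¬ Tame (freeClass {K3, C4}) := by
  refine not_tame_of_two_pow_le 2 2 fun n =>
    ⟨ladderGraph (star n) {x | x ≠ none}, ?_, ?_, ?_⟩
  · rintro H (rfl | rfl)
    · rw [K3_isIndContained_iff]
      change ¬ HasTriangle (ladder _ _)
      rintro ⟨⟨s, x⟩, ⟨t, y⟩, ⟨u, z⟩, h⟩
      simp only [ladder, star, Set.mem_ofPred_eq] at h
      cases s <;> cases t <;> cases u <;> simp at h <;> grind
    · rw [isQuad_C4.isIndContained_iff]
      change ¬ HasC4 (ladder _ _)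
      rintro ⟨⟨s, x⟩, ⟨t, y⟩, ⟨u, z⟩, ⟨v, w⟩, hne, h⟩
      simp only [ladder, star, Set.mem_ofPred_eq] at h
      cases s <;> cases t <;> cases u <;> cases v <;> simp at h <;> grind
  · rw [order_ladderGraph, Nat.card_eq_fintype_card]
    simp
    ring
  · refine two_pow_le_numMinSeparators (fun t x => x.elim true t) some (fun _ => by simp)
      (fun _ _ => rfl) (fun t s => ⟨none, by simp [active], fun w hw => ?_⟩)
      (fun t w hw => ⟨none, by simp [active], Or.inr ⟨hw, rfl⟩⟩)
    by_cases hw' : w = none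
    · subst hw'; exact ReflTransGen.refl
    · exact ReflTransGen.single ⟨Or.inl ⟨rfl, hw'⟩, fun h => h hw⟩

/-- A path on the even numbers in which each edge is completed to a triangle by the odd number
in between. -/
def trianglePath (n : ℕ) : SimpleGraph (Fin (2 * n + 1)) where
  Adj i j := i.1 + 1 = j.1 ∨ j.1 + 1 = i.1 ∨ (i.1 % 2 = 0 ∧ (i.1 + 2 = j.1 ∨ j.1 + 2 = i.1))
  symm := ⟨fun i j h => by omega⟩
  loopless := ⟨fun i h => by omega⟩

theorem ladder_trianglePath_adj {n : ℕ} {s t : Bool} {i j : Fin (2 * n + 1)} :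
    (ladder (trianglePath n) {i | i.1 % 2 = 1}).Adj (s, i) (t, j) ↔
      (s = t ∧ (i.1 + 1 = j.1 ∨ j.1 + 1 = i.1 ∨
        (i.1 % 2 = 0 ∧ (i.1 + 2 = j.1 ∨ j.1 + 2 = i.1)))) ∨
      (s ≠ t ∧ i.1 = j.1 ∧ i.1 % 2 = 1) := by
  simp only [ladder, trianglePath, Set.mem_ofPred_eq, Fin.ext_iff]

/-- Rungs join the odd vertices of two triangle paths. Each neighbourhood is a disjoint union of at
most two cliques of size at most two, with no edges between them, which excludes claw, `K₄` and
diamond. A cycle through both copies uses two rungs, whose ends in a copy are not adjacent, so it is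
longer than four. -/
theorem not_tame_claw_K4_C4_diamond : ¬ Tame (freeClass {claw, K4, C4, diamond}) := by
  refine not_tame_of_two_pow_le 4 2 fun n =>
    ⟨ladderGraph (trianglePath n) {i | i.1 % 2 = 1}, ?_, ?_, ?_⟩
  · rintro H (rfl | rfl | rfl | rfl)
    · rw [isQuad_claw.isIndContained_iff]
      change ¬ HasClaw (ladder _ _)
      rintro ⟨⟨s, x⟩, ⟨t, y⟩, ⟨u, z⟩, ⟨v, w⟩, hne, h⟩
      simp only [ladder_trianglePath_adj] at h
      simp only [ne_eq, Prod.mk.injEq, Fin.ext_iff] at hne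
      cases s <;> cases t <;> cases u <;> cases v <;> simp at h <;> grind
    · rw [isQuad_K4.isIndContained_iff]
      change ¬ HasK4 (ladder _ _)
      rintro ⟨⟨s, x⟩, ⟨t, y⟩, ⟨u, z⟩, ⟨v, w⟩, hne, h⟩
      simp only [ladder_trianglePath_adj] at h
      simp only [ne_eq, Prod.mk.injEq, Fin.ext_iff] at hne
      cases s <;> cases t <;> cases u <;> cases v <;> simp at h <;> grind
    · rw [isQuad_C4.isIndContained_iff]
      change ¬ HasC4 (ladder _ _)
      rintro ⟨⟨s, x⟩, ⟨t, y⟩, ⟨u, z⟩, ⟨v, w⟩, hne, h⟩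
      simp only [ladder_trianglePath_adj] at h
      simp only [ne_eq, Prod.mk.injEq, Fin.ext_iff] at hne
      cases s <;> cases t <;> cases u <;> cases v <;> simp at h hne <;> omega
    · rw [isQuad_diamond.isIndContained_iff]
      change ¬ HasDiamond (ladder _ _)
      rintro ⟨⟨s, x⟩, ⟨t, y⟩, ⟨u, z⟩, ⟨v, w⟩, hne, h⟩
      simp only [ladder_trianglePath_adj] at h
      simp only [ne_eq, Prod.mk.injEq, Fin.ext_iff] at hne
      cases s <;> cases t <;> cases u <;> cases v <;> simp at h <;> grind
  · rw [order_ladderGraph, Nat.card_eq_fintype_card, Fintype.card_fin]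
    ring
  · have heven : ∀ (t : Fin n → Bool) (s : Bool) (i : Fin (2 * n + 1)), i.1 % 2 = 0 →
        i ∈ active {i : Fin (2 * n + 1) | i.1 % 2 = 1}
          (fun i => if h : i.1 / 2 < n then t ⟨i.1 / 2, h⟩ else true) s := by
      intro t s i hi hi'
      rw [Set.mem_ofPred_eq] at hi'
      omega
    -- The default `true` is used only at the last vertex `2n`, which is even and carries no rung.
    refine two_pow_le_numMinSeparators
      (fun t i => if h : i.1 / 2 < n then t ⟨i.1 / 2, h⟩ else true)
      (fun i => ⟨2 * i.1 + 1, by omega⟩) (fun i => ?_) (fun t i => ?_)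
      (fun t s => ⟨0, heven t s 0 rfl, fun w hw => ?_⟩)
      (fun t w hw => ⟨⟨w.1 - 1, by omega⟩, heven t _ _ ?_, ?_⟩)
    · rw [Set.mem_ofPred_eq]
      dsimp only
      omega
    · have : (2 * i.1 + 1) / 2 = i.1 := by omega
      simp [this]
    -- Even vertices are never removed: an even `k` is reached from `k - 2` and an odd `k` from `k -
    -- 1`, so each predecessor survives.
    · obtain ⟨k, hk⟩ := w
      induction k using Nat.strong_induction_on with
      | _ k ih =>
        rcases Nat.eq_zero_or_pos k with rfl | hpos
        · exact ReflTransGen.refl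
        · rcases Nat.mod_two_eq_zero_or_one k with h0 | h1
          · refine ReflTransGen.tail (ih (k - 2) (by omega) (by omega) (heven t s _ ?_))
              ⟨?_, fun h => h hw⟩
            · dsimp only; omega
            · change _ ∨ _ ∨ _
              dsimp only
              omega
          · refine ReflTransGen.tail (ih (k - 1) (by omega) (by omega) (heven t s _ ?_))
              ⟨?_, fun h => h hw⟩
            · dsimp only; omega
            · change _ ∨ _ ∨ _
              dsimp only
              omega
    · rw [Set.mem_ofPred_eq] at hw
      dsimp only
      omega
    · rw [Set.mem_ofPred_eq] at hw
      change _ ∨ _ ∨ _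
      dsimp only
      omega

end Examples
end FinGraph

theorem theorem2 (F : Set FinGraph) (hF : ∀ H ∈ F, H.order ≤ 4)
    (h₁ : ¬ FinGraph.FamilyEq F {FinGraph.fourP1, FinGraph.C4})
    (h₂ : ¬ FinGraph.FamilyEq F {FinGraph.fourP1, FinGraph.C4, FinGraph.claw}) :
    ¬ FinGraph.Tame (FinGraph.freeClass F) ↔
      (FinGraph.FamilyLE {FinGraph.threeP1, FinGraph.diamond} F ∨
        FinGraph.FamilyLE
          {FinGraph.claw, FinGraph.K4, FinGraph.C4, FinGraph.diamond} F ∨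
        FinGraph.FamilyLE {FinGraph.K3, FinGraph.C4} F) := by
  constructor
  · intro h
    by_contra! ⟨hi, hii, hiii⟩
    exact h (FinGraph.tame_freeClass hF h₁ h₂ hi hii hiii)
  · rintro (h | h | h) ht
    · exact FinGraph.not_tame_threeP1_diamond (ht.mono h)
    · exact FinGraph.not_tame_claw_K4_C4_diamond (ht.mono h)
    · exact FinGraph.not_tame_K3_C4 (ht.mono h)
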